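/- Let $k\in\{1,2,\dots\}\cup\{\infty\}$, let $M$ be a (nonempty) connected $C^k$ manifold without boundary modelled on a real Banach space, with a countable base of topology (for instance, separable and metrizable), let $V$ be an open subset of a separable real Banach space $Y$, and let $f\colon M\to V$ be a map of class $C^k$ which is Fredholm: for every $x\in M$ the differential $Df(x)$ has finite-dimensional kernel and closed image of finite codimension. Let $\operatorname{Ind} f=\dim\ker Df(x)-\operatorname{codim}\operatorname{Im}Df(x)$, which does not depend on $x$ because $M$ is connected, and assume that $k>\max(\operatorname{Ind} f,0)$. Let $R\subset V$ be the set of regular values of $f$, that is, of those $y\in V$ such that $Df(x)$ is surjective for every $x\in M$ with $f(x)=y$. Then $R$ is generic in $V$, i.e. it contains a countable intersection of dense open subsets of $V$, and $R$ is prevalent in $V$, i.e. $V\setminus R$ is contained in a Borel set $B\subset Y$ for which there is a finite nonzero Borel measure $\mu\ge 0$ on $Y$ with compact support such that $\mu(y+B)=0$ for all $y\in Y$. -/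

import Mathlib

open scoped Manifold ContDiff

/-- `G` is generic in `U`: `G` is a subset of `U` which contains a countable intersection of
dense open subsets of `U` (for open `U`). -/
def IsGenericIn {X : Type*} [TopologicalSpace X] (U G : Set X) : Prop :=
  G ⊆ U ∧ ∃ O : ℕ → Set X,
    (∀ n, IsOpen (O n) ∧ O n ⊆ U ∧ U ⊆ closure (O n)) ∧ ⋂ n, O n ⊆ G

/-- `A` is Haar-null: it is contained in a Borel set `B` for which there is a finite nonzero
measure with compact support (that is, concentrated on a compact set) vanishing on every translate
of `B`. The measurable structure is meant to be the Borel one. -/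
def IsHaarNull {X : Type*} [NormedAddCommGroup X] [MeasurableSpace X] (A : Set X) : Prop :=
  ∃ B : Set X, MeasurableSet B ∧ A ⊆ B ∧
    ∃ μ : MeasureTheory.Measure X, MeasureTheory.IsFiniteMeasure μ ∧ μ ≠ 0 ∧
      (∃ K : Set X, IsCompact K ∧ μ Kᶜ = 0) ∧
      ∀ x : X, μ ((fun b => x + b) '' B) = 0

/-- `G` is prevalent in `U`: `G` is a subset of `U` and `U \ G` is Haar-null in the whole space. -/
def IsPrevalentIn {X : Type*} [NormedAddCommGroup X] [MeasurableSpace X] (U G : Set X) : Prop :=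
  G ⊆ U ∧ IsHaarNull (U \ G)

/-- `y` is a regular value of `f` on the manifold `M` modelled on `E`: the differential of `f` is
surjective at every point of the fibre over `y`. -/
def IsRegularValue (E : Type*) [NormedAddCommGroup E] [NormedSpace ℝ E]
    {M : Type*} [TopologicalSpace M] [ChartedSpace E M]
    {Y : Type*} [NormedAddCommGroup Y] [NormedSpace ℝ Y] (f : M → Y) (y : Y) : Prop :=
  ∀ x : M, f x = y → Function.Surjective (mfderiv 𝓘(ℝ, E) 𝓘(ℝ, Y) f x)

/-- `f` is a Fredholm map: it is differentiable and all its differentials are Fredholm operators. -/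
def IsFredholmMap (E : Type*) [NormedAddCommGroup E] [NormedSpace ℝ E]
    {M : Type*} [TopologicalSpace M] [ChartedSpace E M]
    {Y : Type*} [NormedAddCommGroup Y] [NormedSpace ℝ Y] (f : M → Y) : Prop :=
  MDifferentiable 𝓘(ℝ, E) 𝓘(ℝ, Y) f ∧
    ∀ x : M, (mfderiv 𝓘(ℝ, E) 𝓘(ℝ, Y) f x).IsFredholm

/-- The index of `f`: the index `dim ker - codim range` of its differential at some point. For a
`C^1` Fredholm map on a connected manifold the choice of the point does not matter. -/
noncomputable def mapIndex (E : Type*) [NormedAddCommGroup E] [NormedSpace ℝ E]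
    {M : Type*} [TopologicalSpace M] [ChartedSpace E M] [Nonempty M]
    {Y : Type*} [NormedAddCommGroup Y] [NormedSpace ℝ Y] (f : M → Y) : ℤ :=
  (mfderiv 𝓘(ℝ, E) 𝓘(ℝ, Y) f (Classical.arbitrary M)).toLinearMap.index

/-!
# The Sard–Smale theorem with prevalence

Let `m` be the dimension of the cokernel of the differential `D` of `f` at a critical point, and `n`
that of its kernel. With a generalized inverse `q` of `D`, the map `f` becomes linear in suitable
local coordinates, up to a component with values in the `m`-dimensional space `ker q`
(`exists_fredholm_coordinates`). At the nearby points whose cokernel also has dimension `m`, the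
map is stationary in the `n` directions of `ker D`, since the index `n - m` is locally constant.
Hence every translate of the image of these points meets `ker q` in the image of points of *rank
zero* of a `C^k` map from an `n`-dimensional to an `m`-dimensional space. This reduction by strata of
constant cokernel replaces the usual induction and Fubini argument of Sard's theorem. The image is
closed because the kernel directions are finite-dimensional (`exists_local_null_critical_values`).

Images of sets of points of rank zero are null as soon as `n ≤ k m`, which follows from
`k ≥ n - m + 1` and `k, m ≥ 1` (`volume_image_eq_zero_of_fderiv_eq_zero`). Almost everywhere on such
a set `A`, the map varies by `o(‖y - x‖ ^ k)`, by a density point argument for the successive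
derivatives, and the image of this part is null by a covering by small pieces. What remains is a
null set, to which Morse's decomposition applies (`isSigmaFlat_of_contDiffOn`): `A` is a countable
union of sets on which the map is Hölder of exponent `k`, and such maps send sets of vanishing
`k m`-dimensional Hausdorff measure to null sets.

By the Lindelöf property, the critical values lie in countably many closed sets `Z n`, each having
a compactly supported test measure that vanishes on its translates. On a separable space such sets
have dense complements, which gives genericity, and their union again has a test measure, the law of
a convergent sum of independent small random vectors (`HasNullTranslates.iUnion`), which gives
prevalence.
-/

open Set Filter MeasureTheory Topology
open scoped NNReal ENNReal

/-! ### A rank-zero Morse–Sard theorem: Morse's decomposition -/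

/-- A `C^k` map `Φ` whose differential at `x₀` is the identity has a `C^k` local inverse `Ψ`, with a
bound `K` both on the differential of `Ψ` and on the Lipschitz constant of `Φ` near `x₀`. -/
theorem exists_localInverse_of_hasFDerivAt_id {E : Type*} [NormedAddCommGroup E] [NormedSpace ℝ E]
    [CompleteSpace E] {k : ℕ} (hk : k ≠ 0) {U : Set E} (hU : IsOpen U) {x₀ : E} (hx₀ : x₀ ∈ U)
    {Φ : E → E} (hΦ : ContDiffOn ℝ k Φ U) (hid : HasFDerivAt Φ (ContinuousLinearMap.id ℝ E) x₀) :
    ∃ (Ψ : E → E) (r : ℝ) (N : Set E) (K : ℝ), 0 < r ∧ 0 ≤ K ∧ IsOpen N ∧ x₀ ∈ N ∧ N ⊆ U ∧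
      ContDiffOn ℝ k Ψ (Metric.ball (Φ x₀) r) ∧
      (∀ ξ ∈ Metric.ball (Φ x₀) r, Ψ ξ ∈ U ∧ Φ (Ψ ξ) = ξ ∧ ‖fderiv ℝ Ψ ξ‖ ≤ K) ∧
      (∀ x ∈ N, Φ x ∈ Metric.ball (Φ x₀) r ∧ Ψ (Φ x) = x) ∧
      (∀ x ∈ N, ∀ y ∈ N, ‖Φ x - Φ y‖ ≤ K * ‖x - y‖) := by
  have hk' : (k : WithTop ℕ∞) ≠ 0 := by exact_mod_cast hk
  have hk1 : (1 : WithTop ℕ∞) ≤ k := by exact_mod_cast Nat.one_le_iff_ne_zero.2 hk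
  have hat : ContDiffAt ℝ k Φ x₀ := hΦ.contDiffAt (hU.mem_nhds hx₀)
  have hid' : HasFDerivAt Φ ((ContinuousLinearEquiv.refl ℝ E : E ≃L[ℝ] E) : E →L[ℝ] E) x₀ := hid
  have hstrict := hat.hasStrictFDerivAt' hid' hk'
  set Ψ := hat.localInverse hid' hk' with hΨdef
  have hΨ : ContDiffAt ℝ k Ψ (Φ x₀) := hat.to_localInverse hid' hk'
  have hΨx : Ψ (Φ x₀) = x₀ := hat.localInverse_apply_image hid' hk'
  have hr : ∀ᶠ ξ in 𝓝 (Φ x₀), Φ (Ψ ξ) = ξ := hstrict.eventually_right_inverse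
  have hl : ∀ᶠ x in 𝓝 x₀, Ψ (Φ x) = x := hstrict.eventually_left_inverse
  have hsm : ∀ᶠ ξ in 𝓝 (Φ x₀), ContDiffAt ℝ k Ψ ξ := hΨ.eventually (by simp)
  have hΨU : ∀ᶠ ξ in 𝓝 (Φ x₀), Ψ ξ ∈ U :=
    hΨ.continuousAt.eventually (by rw [hΨx]; exact hU.mem_nhds hx₀)
  have hbd : ∀ᶠ ξ in 𝓝 (Φ x₀), ‖fderiv ℝ Ψ ξ‖ < ‖fderiv ℝ Ψ (Φ x₀)‖ + 1 := by
    have : ContinuousAt (fderiv ℝ Ψ) (Φ x₀) :=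
      (hΨ.fderiv_right (m := 0) (by simpa using hk1)).continuousAt
    exact this.norm.eventually (gt_mem_nhds (by linarith))
  obtain ⟨r, hr0, hball⟩ := Metric.eventually_nhds_iff_ball.1 (hr.and (hsm.and (hΨU.and hbd)))
  obtain ⟨K₁, s, hs, hlip⟩ := (hat.of_le hk1).exists_lipschitzOnWith
  have hN : ∀ᶠ x in 𝓝 x₀, Ψ (Φ x) = x ∧ x ∈ U ∧ x ∈ s ∧ Φ x ∈ Metric.ball (Φ x₀) r :=
    hl.and ((hU.eventually_mem hx₀).and ((eventually_of_mem hs fun _ h => h).and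
      (hat.continuousAt.eventually (Metric.ball_mem_nhds _ hr0))))
  obtain ⟨N, hNsub, hNo, hxN⟩ := eventually_nhds_iff.1 hN
  refine ⟨Ψ, r, N, max (‖fderiv ℝ Ψ (Φ x₀)‖ + 1) K₁, hr0, le_max_of_le_right K₁.2, hNo, hxN,
    fun x hx => (hNsub x hx).2.1, fun ξ hξ => (hball ξ hξ).2.1.contDiffWithinAt,
    fun ξ hξ => ⟨(hball ξ hξ).2.2.1, (hball ξ hξ).1,
      (hball ξ hξ).2.2.2.le.trans (le_max_left _ _)⟩,
    fun x hx => ⟨(hNsub x hx).2.2.2, (hNsub x hx).1⟩, fun x hx y hy => ?_⟩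
  refine (hlip.norm_sub_le (hNsub x hx).2.2.1 (hNsub y hy).2.2.1).trans ?_
  gcongr
  exact le_max_right _ _

/-- Any two points `x`, `y` of `S` are joined by a differentiable path in `U`, of speed
`O(‖x - y‖)`, along which `g` is `O(‖x - y‖ ^ k)`. -/
def IsFlatAlongPaths {E G : Type*} [NormedAddCommGroup E] [NormedSpace ℝ E]
    [NormedAddCommGroup G] (g : E → G) (U : Set E) (k : ℕ) (S : Set E) : Prop :=
  ∃ C : ℝ, 0 ≤ C ∧ ∀ x ∈ S, ∀ y ∈ S, ∃ γ γ' : ℝ → E, γ 0 = x ∧ γ 1 = y ∧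
    ∀ t ∈ Icc (0 : ℝ) 1, γ t ∈ U ∧ HasDerivWithinAt γ (γ' t) (Icc 0 1) t ∧
      ‖γ' t‖ ≤ C * ‖x - y‖ ∧ ‖g (γ t)‖ ≤ C * ‖x - y‖ ^ k

/-- `A` is covered by countably many sets on which `g` is flat of order `k` along paths in `U`. -/
def IsSigmaFlat {E G : Type*} [NormedAddCommGroup E] [NormedSpace ℝ E]
    [NormedAddCommGroup G] (g : E → G) (U : Set E) (k : ℕ) (A : Set E) : Prop :=
  ∃ T : Set (Set E), T.Countable ∧ A ⊆ ⋃₀ T ∧ ∀ S ∈ T, IsFlatAlongPaths g U k S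

section Flat

variable {E G : Type*} [NormedAddCommGroup E] [NormedSpace ℝ E] [NormedAddCommGroup G]
  {g : E → G} {U A B : Set E} {k : ℕ}

theorem IsSigmaFlat.mono (h : IsSigmaFlat g U k B) (hAB : A ⊆ B) : IsSigmaFlat g U k A := by
  obtain ⟨T, hT, hBT, hflat⟩ := h
  exact ⟨T, hT, hAB.trans hBT, hflat⟩

theorem IsSigmaFlat.union (hA : IsSigmaFlat g U k A) (hB : IsSigmaFlat g U k B) :
    IsSigmaFlat g U k (A ∪ B) := by
  obtain ⟨T, hT, hAT, hflat⟩ := hA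
  obtain ⟨T', hT', hBT', hflat'⟩ := hB
  refine ⟨T ∪ T', hT.union hT', ?_, ?_⟩
  · rw [sUnion_union]
    exact union_subset_union hAT hBT'
  · rintro S (hS | hS)
    exacts [hflat S hS, hflat' S hS]

/-- By the Lindelöf property, flatness up to countable unions is a local property. -/
theorem IsSigmaFlat.of_locally [SecondCountableTopology E]
    (h : ∀ x ∈ A, ∃ N ∈ 𝓝[A] x, IsSigmaFlat g U k N) : IsSigmaFlat g U k A := by
  choose! N hN hflat using h
  obtain ⟨t, htA, htc, hcov⟩ := TopologicalSpace.countable_cover_nhdsWithin hN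
  choose! T hTc hNT hT using hflat
  refine ⟨⋃ x ∈ t, T x, htc.biUnion fun x hx => hTc x (htA hx), fun a ha => ?_, ?_⟩
  · obtain ⟨x, hx, hax⟩ := mem_iUnion₂.1 (hcov ha)
    obtain ⟨S, hS, haS⟩ := hNT x (htA hx) hax
    exact ⟨S, mem_iUnion₂.2 ⟨x, hx, hS⟩, haS⟩
  · intro S hS
    obtain ⟨x, hx, hSx⟩ := mem_iUnion₂.1 hS
    exact hT x (htA hx) S hSx

end Flat

/-- If the differential of `g` is flat of order `k` along paths, then along the same paths `g`
differs from its initial value by a quantity of order `k + 1`. -/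
theorem IsFlatAlongPaths.of_fderiv {E G : Type*} [NormedAddCommGroup E] [NormedSpace ℝ E]
    [NormedAddCommGroup G] [NormedSpace ℝ G] {g : E → G} {U S : Set E} {k : ℕ} (hU : IsOpen U)
    (hg : DifferentiableOn ℝ g U) (h : IsFlatAlongPaths (fderiv ℝ g) U k S) :
    ∃ C : ℝ, 0 ≤ C ∧ ∀ x ∈ S, ∀ y ∈ S, ∃ γ γ' : ℝ → E, γ 0 = x ∧ γ 1 = y ∧
      ∀ t ∈ Icc (0 : ℝ) 1, γ t ∈ U ∧ HasDerivWithinAt γ (γ' t) (Icc 0 1) t ∧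
        ‖γ' t‖ ≤ C * ‖x - y‖ ∧ ‖g (γ t) - g x‖ ≤ C * ‖x - y‖ ^ (k + 1) := by
  obtain ⟨C, hC, h⟩ := h
  refine ⟨max C (C * C), le_max_of_le_left hC, fun x hx y hy => ?_⟩
  obtain ⟨γ, γ', h0, h1, hγ⟩ := h x hx y hy
  refine ⟨γ, γ', h0, h1, fun t ht => ⟨(hγ t ht).1, (hγ t ht).2.1, (hγ t ht).2.2.1.trans ?_, ?_⟩⟩
  · gcongr
    exact le_max_left _ _
  · have hd : ∀ s ∈ Icc (0 : ℝ) 1,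
        HasDerivWithinAt (g ∘ γ) (fderiv ℝ g (γ s) (γ' s)) (Icc 0 1) s := fun s hs =>
      ((hg.differentiableAt (hU.mem_nhds (hγ s hs).1)).hasFDerivAt).comp_hasDerivWithinAt s
        (hγ s hs).2.1
    have hb : ∀ s ∈ Icc (0 : ℝ) 1,
        ‖fderiv ℝ g (γ s) (γ' s)‖ ≤ (C * ‖x - y‖ ^ k) * (C * ‖x - y‖) := fun s hs =>
      ((fderiv ℝ g (γ s)).le_opNorm _).trans
        (mul_le_mul (hγ s hs).2.2.2 (hγ s hs).2.2.1 (norm_nonneg _) (by positivity))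
    have := (convex_Icc (0 : ℝ) 1).norm_image_sub_le_of_norm_hasDerivWithin_le hd hb
      (left_mem_Icc.2 zero_le_one) ht
    simp only [Function.comp_apply, h0, sub_zero] at this
    refine this.trans ?_
    have ht1 : ‖t‖ ≤ 1 := by
      rw [Real.norm_eq_abs, abs_of_nonneg ht.1]
      exact ht.2
    calc C * ‖x - y‖ ^ k * (C * ‖x - y‖) * ‖t‖
        ≤ C * ‖x - y‖ ^ k * (C * ‖x - y‖) * 1 := by gcongr
      _ = C * C * ‖x - y‖ ^ (k + 1) := by ring
      _ ≤ _ := by gcongr; exact le_max_right _ _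

theorem isSigmaFlat_zero {E G : Type*} [NormedAddCommGroup E] [NormedSpace ℝ E]
    [FiniteDimensional ℝ E] [NormedAddCommGroup G] {U A : Set E} (hU : IsOpen U) {g : E → G}
    (hg : ContinuousOn g U) (hA : A ⊆ U) : IsSigmaFlat g U 0 A := by
  have : ProperSpace E := FiniteDimensional.proper ℝ E
  refine .of_locally fun x hx => ?_
  have hbd : ∀ᶠ y in 𝓝 x, ‖g y‖ < ‖g x‖ + 1 ∧ y ∈ U :=
    ((hg.continuousAt (hU.mem_nhds (hA hx))).norm.eventually (gt_mem_nhds (by linarith))).and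
      (hU.mem_nhds (hA hx))
  obtain ⟨r, hr, hball⟩ := Metric.eventually_nhds_iff_ball.1 hbd
  refine ⟨Metric.ball x r, mem_nhdsWithin_of_mem_nhds (Metric.ball_mem_nhds x hr),
    {Metric.ball x r}, countable_singleton _, by simp, ?_⟩
  rintro S rfl
  refine ⟨‖g x‖ + 1, by positivity, fun y hy z hz =>
    ⟨AffineMap.lineMap y z, fun _ => z - y, by simp, by simp, fun t ht => ?_⟩⟩
  have hmem : AffineMap.lineMap y z t ∈ Metric.ball x r :=
    (convex_ball x r).lineMap_mem hy hz ht
  refine ⟨(hball _ hmem).2, AffineMap.hasDerivWithinAt_lineMap, ?_, ?_⟩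
  · rw [norm_sub_rev z y]
    nlinarith [norm_nonneg (y - z), norm_nonneg (g x)]
  · simpa using (hball _ hmem).1.le

/-- **Morse's decomposition.** The zero set of a `C^k` map on a finite-dimensional space is covered
by countably many sets on which the map is flat of order `k` along paths.

The proof is by induction on `k` and, for fixed `k`, on the dimension. Where the differential also
vanishes, the differential is flat of order `k - 1` along paths, and integrating it along these
paths gains one order. Elsewhere, the zero set locally lies in a hypersurface of class `C^k`, and
the restriction of the map to it is still of class `C^k`. -/
theorem isSigmaFlat_of_contDiffOn.{u} (k : ℕ) : ∀ (n : ℕ) (E G : Type u) [NormedAddCommGroup E]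
    [NormedSpace ℝ E] [FiniteDimensional ℝ E] [NormedAddCommGroup G] [NormedSpace ℝ G]
    (U A : Set E) (g : E → G), Module.finrank ℝ E = n → IsOpen U → ContDiffOn ℝ k g U → A ⊆ U →
    (∀ x ∈ A, g x = 0) → IsSigmaFlat g U k A := by
  induction k with
  | zero =>
    intro n E G _ _ _ _ _ U A g _ hU hg hA _
    exact isSigmaFlat_zero hU hg.continuousOn hA
  | succ k ihk =>
    intro n
    induction n using Nat.strong_induction_on with
    | _ n ihn =>
    intro E G _ _ _ _ _ U A g hn hU hg hA hgA
    have : CompleteSpace E := FiniteDimensional.complete ℝ E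
    have : ProperSpace E := FiniteDimensional.proper ℝ E
    have hdiff : DifferentiableOn ℝ g U := hg.differentiableOn (by simp)
    have hsplit : A ⊆ {x ∈ A | fderiv ℝ g x = 0} ∪ {x ∈ A | fderiv ℝ g x ≠ 0} := fun x hx => by
      by_cases h : fderiv ℝ g x = 0
      exacts [Or.inl ⟨hx, h⟩, Or.inr ⟨hx, h⟩]
    refine IsSigmaFlat.mono (IsSigmaFlat.union ?_ ?_) hsplit
    · obtain ⟨T, hTc, hcov, hT⟩ := ihk n E (E →L[ℝ] G) U {x ∈ A | fderiv ℝ g x = 0} (fderiv ℝ g)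
        hn hU (hg.fderiv_of_isOpen hU (by simp)) (fun x hx => hA hx.1) (fun x hx => hx.2)
      refine ⟨(· ∩ A) '' T, hTc.image _, fun x hx => ?_, ?_⟩
      · obtain ⟨S, hS, hxS⟩ := hcov hx
        exact ⟨S ∩ A, mem_image_of_mem _ hS, hxS, hx.1⟩
      · rintro _ ⟨S, hS, rfl⟩
        obtain ⟨C, hC, h⟩ := (hT S hS).of_fderiv hU hdiff
        refine ⟨C, hC, fun x hx y hy => ?_⟩
        obtain ⟨γ, γ', h0, h1, hγ⟩ := h x hx.1 y hy.1
        refine ⟨γ, γ', h0, h1, fun t ht => ?_⟩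
        have := hγ t ht
        rwa [hgA x hx.2, sub_zero] at this
    · refine .of_locally fun x₀ hx₀ => ?_
      have hx₀U := hA hx₀.1
      obtain ⟨w, hw⟩ : ∃ w, fderiv ℝ g x₀ w ≠ 0 := by
        by_contra! h
        exact hx₀.2 (ContinuousLinearMap.ext h)
      obtain ⟨l, -, hl⟩ := exists_dual_vector ℝ (fderiv ℝ g x₀ w) (norm_ne_zero_iff.2 hw)
      set L : E →L[ℝ] ℝ := l ∘L fderiv ℝ g x₀ with hL
      have hLw : L w ≠ 0 := by
        rw [hL, ContinuousLinearMap.comp_apply, hl]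
        simpa using hw
      set v : E := (L w)⁻¹ • w with hv
      have hLv : L v = 1 := by simp [hv, hLw]
      -- In the coordinate `Φ`, the zero set of `g` lies in the hyperplane `x₀ + ker L`.
      set Φ : E → E := fun x => x + (l (g x) - L (x - x₀)) • v with hΦdef
      have hΦ : ContDiffOn ℝ (k + 1 : ℕ) Φ U := by
        have h1 : ContDiffOn ℝ (k + 1 : ℕ) (fun x => l (g x)) U := l.contDiff.comp_contDiffOn hg
        have h2 : ContDiff ℝ (k + 1 : ℕ) (fun x => L (x - x₀)) :=
          L.contDiff.comp (contDiff_id.sub contDiff_const)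
        exact contDiffOn_id.add ((h1.sub h2.contDiffOn).smul contDiffOn_const)
      have hΦx₀ : Φ x₀ = x₀ := by simp [hΦdef, hgA x₀ hx₀.1]
      have hid : HasFDerivAt Φ (ContinuousLinearMap.id ℝ E) x₀ := by
        have h1 : HasFDerivAt (fun x => l (g x)) L x₀ :=
          l.hasFDerivAt.comp x₀ (hdiff.differentiableAt (hU.mem_nhds hx₀U)).hasFDerivAt
        have h2 : HasFDerivAt (fun x => L (x - x₀)) L x₀ :=
          L.hasFDerivAt.comp x₀ ((hasFDerivAt_id x₀).sub_const x₀)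
        have h3 := (hasFDerivAt_id x₀).add ((h1.sub h2).smul_const v)
        rw [sub_self, ContinuousLinearMap.zero_smulRight, add_zero] at h3
        exact h3
      have hLΦ : ∀ x, g x = 0 → L (Φ x - x₀) = 0 := fun x hx => by
        simp [hΦdef, hx, hLv]
      obtain ⟨Ψ, r, N, K, hr, hK, hNo, hxN, hNU, hΨ, hball, hN, hlip⟩ :=
        exists_localInverse_of_hasFDerivAt_id (Nat.succ_ne_zero k) hU hx₀U hΦ hid
      rw [hΦx₀] at hΨ hball hN
      have hrank : Module.finrank ℝ L.ker < n := by
        rw [← hn]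
        refine Submodule.finrank_lt fun h => ?_
        have : v ∈ L.ker := h ▸ Submodule.mem_top
        rw [LinearMap.mem_ker] at this
        exact one_ne_zero (hLv.symm.trans this)
      let ι : L.ker → E := fun u => x₀ + u
      have hι : ContDiff ℝ (k + 1 : ℕ) ι := contDiff_const.add L.ker.subtypeL.contDiff
      set U' : Set L.ker := ι ⁻¹' Metric.ball x₀ r with hU'
      have hU'o : IsOpen U' := Metric.isOpen_ball.preimage hι.continuous
      set A' : Set L.ker := {u ∈ U' | ∃ a ∈ N ∩ A, Φ a = ι u} with hA'
      have hΨι : ContDiffOn ℝ (k + 1 : ℕ) (Ψ ∘ ι) U' :=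
        hΨ.comp hι.contDiffOn fun u hu => hu
      have hgΨ : ContDiffOn ℝ (k + 1 : ℕ) (fun u : L.ker => g (Ψ (ι u))) U' :=
        hg.comp hΨι fun u hu => (hball _ hu).1
      obtain ⟨T, hTc, hcov, hT⟩ := ihn _ hrank L.ker G U' A' (fun u => g (Ψ (ι u))) rfl hU'o hgΨ
        (fun u hu => hu.1) (by
          rintro u ⟨hu, a, ha, hau⟩
          rw [← hau, (hN a ha.1).2]
          exact hgA a ha.2)
      refine ⟨N ∩ {x ∈ A | fderiv ℝ g x ≠ 0},
        inter_mem (mem_nhdsWithin_of_mem_nhds (hNo.mem_nhds hxN)) self_mem_nhdsWithin,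
        (fun S => (Ψ ∘ ι) '' (S ∩ A')) '' T, hTc.image _, ?_, ?_⟩
      · rintro x ⟨hxN', hxA, -⟩
        have hu : Φ x - x₀ ∈ L.ker := LinearMap.mem_ker.2 (hLΦ x (hgA x hxA))
        have hιu : ι ⟨Φ x - x₀, hu⟩ = Φ x := by simp [ι]
        have huA' : (⟨Φ x - x₀, hu⟩ : L.ker) ∈ A' := by
          refine ⟨?_, x, ⟨hxN', hxA⟩, hιu.symm⟩
          rw [hU', mem_preimage, hιu]
          exact (hN x hxN').1
        obtain ⟨S, hS, huS⟩ := hcov huA'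
        refine ⟨_, mem_image_of_mem _ hS, ⟨_, ⟨huS, huA'⟩, ?_⟩⟩
        rw [Function.comp_apply, hιu, (hN x hxN').2]
      · rintro _ ⟨S, hS, rfl⟩
        obtain ⟨C, hC, h⟩ := hT S hS
        refine ⟨max (K * (C * K)) (C * K ^ (k + 1)), le_max_of_le_left (by positivity), ?_⟩
        rintro _ ⟨u, ⟨huS, -, a, haN, hau⟩, rfl⟩ _ ⟨u', ⟨hu'S, -, a', ha'N, hau'⟩, rfl⟩
        obtain ⟨γ, γ', h0, h1, hγ⟩ := h u huS u' hu'S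
        have huu : ‖u - u'‖ ≤ K * ‖(Ψ ∘ ι) u - (Ψ ∘ ι) u'‖ := by
          have e1 : ‖u - u'‖ = ‖ι u - ι u'‖ := by
            simp only [ι, add_sub_add_left_eq_sub]
            rfl
          rw [e1, Function.comp_apply, Function.comp_apply, ← hau, ← hau', (hN a haN.1).2,
            (hN a' ha'N.1).2]
          exact hlip a haN.1 a' ha'N.1
        refine ⟨Ψ ∘ ι ∘ γ, fun t => fderiv ℝ Ψ (ι (γ t)) (γ' t), by simp [h0], by simp [h1],
          fun t ht => ?_⟩
        obtain ⟨ht1, ht2, ht3, ht4⟩ := hγ t ht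
        refine ⟨(hball _ ht1).1, ?_, ?_, ?_⟩
        · have d1 : HasDerivWithinAt (ι ∘ γ) (γ' t : E) (Icc 0 1) t :=
            (L.ker.subtypeL.hasFDerivAt.comp_hasDerivWithinAt t ht2).const_add x₀
          have d2 : DifferentiableAt ℝ Ψ (ι (γ t)) :=
            (hΨ.differentiableOn (by simp)).differentiableAt (Metric.isOpen_ball.mem_nhds ht1)
          exact d2.hasFDerivAt.comp_hasDerivWithinAt t d1
        · calc ‖fderiv ℝ Ψ (ι (γ t)) (γ' t)‖ ≤ K * ‖γ' t‖ :=
                (fderiv ℝ Ψ (ι (γ t))).le_of_opNorm_le (hball _ ht1).2.2 _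
            _ ≤ K * (C * (K * ‖(Ψ ∘ ι) u - (Ψ ∘ ι) u'‖)) := by gcongr; exact ht3.trans (by gcongr)
            _ = K * (C * K) * ‖(Ψ ∘ ι) u - (Ψ ∘ ι) u'‖ := by ring
            _ ≤ _ := by gcongr; exact le_max_left _ _
        · calc ‖g ((Ψ ∘ ι ∘ γ) t)‖ ≤ C * ‖u - u'‖ ^ (k + 1) := ht4
            _ ≤ C * (K * ‖(Ψ ∘ ι) u - (Ψ ∘ ι) u'‖) ^ (k + 1) := by gcongr
            _ = C * K ^ (k + 1) * ‖(Ψ ∘ ι) u - (Ψ ∘ ι) u'‖ ^ (k + 1) := by ring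
            _ ≤ _ := by gcongr; exact le_max_right _ _

/-! ### A rank-zero Morse–Sard theorem: images of null and of flat sets -/

/-- On the zero set of a `C^1` map the differential vanishes almost everywhere: it vanishes at the
Lebesgue density points. -/
theorem measure_zeros_fderiv_ne_zero {E G : Type*} [NormedAddCommGroup E] [NormedSpace ℝ E]
    [FiniteDimensional ℝ E] [MeasurableSpace E] [BorelSpace E] (μ : Measure E) [μ.IsAddHaarMeasure]
    [NormedAddCommGroup G] [NormedSpace ℝ G] {U : Set E} (hU : IsOpen U) {g : E → G}
    (hg : ContDiffOn ℝ 1 g U) : μ {x ∈ U | g x = 0 ∧ fderiv ℝ g x ≠ 0} = 0 := by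
  have : ProperSpace E := FiniteDimensional.proper ℝ E
  refine measure_null_of_locally_null _ fun x₀ hx₀ => ?_
  obtain ⟨hx₀U, -, hx₀⟩ := hx₀
  have hdiff : ∀ x ∈ U, HasFDerivAt g (fderiv ℝ g x) x := fun x hx =>
    ((hg.differentiableOn one_ne_zero).differentiableAt (hU.mem_nhds hx)).hasFDerivAt
  obtain ⟨w, hw⟩ : ∃ w, fderiv ℝ g x₀ w ≠ 0 := by
    by_contra! h
    exact hx₀ (ContinuousLinearMap.ext h)
  have hw0 : w ≠ 0 := by
    rintro rfl
    simp at hw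
  obtain ⟨l, -, hl⟩ := exists_dual_vector ℝ (fderiv ℝ g x₀ w) (norm_ne_zero_iff.2 hw)
  have hlw : l (fderiv ℝ g x₀ w) ≠ 0 := by
    rw [hl]
    simpa using hw
  -- The density theorem applies to the self-map `h x = l (g x) • w`, which vanishes on `s`.
  let h : E → E := fun x => l (g x) • w
  let h' : E → E →L[ℝ] E := fun x => (l ∘L fderiv ℝ g x).smulRight w
  have hh : ∀ x ∈ U, HasFDerivAt h (h' x) x := fun x hx =>
    (l.hasFDerivAt.comp x (hdiff x hx)).smul_const w
  set s : Set E := {x ∈ U | g x = 0} with hs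
  have hsm : MeasurableSet s := by
    have ho : IsOpen (U ∩ g ⁻¹' {0}ᶜ) :=
      hg.continuousOn.isOpen_inter_preimage hU isOpen_compl_singleton
    convert hU.measurableSet.diff ho.measurableSet using 1
    ext x
    simp only [hs, mem_ofPred_eq, Set.mem_sdiff, mem_inter_iff, mem_preimage,
      mem_compl_iff, mem_singleton_iff]
    tauto
  have happ : ApproximatesLinearOn h (0 : E →L[ℝ] E) s 0 := by
    intro x hx y hy
    simp [h, hx.2, hy.2]
  have hae := happ.norm_fderiv_sub_le μ hsm h' fun x hx => (hh x hx.1).hasFDerivWithinAt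
  have hnear : {x | fderiv ℝ g x ∈ {T | l (T w) ≠ 0}} ∈ 𝓝 x₀ := by
    have hc : ContinuousAt (fderiv ℝ g) x₀ :=
      (hg.continuousOn_fderiv_of_isOpen hU le_rfl).continuousAt (hU.mem_nhds hx₀U)
    refine hc.preimage_mem_nhds (IsOpen.mem_nhds ?_ hlw)
    exact isOpen_ne.preimage
      (l.continuous.comp (ContinuousLinearMap.apply ℝ G w).continuous)
  refine ⟨_, inter_mem self_mem_nhdsWithin (mem_nhdsWithin_of_mem_nhds hnear), ?_⟩
  rw [ae_restrict_iff' hsm] at hae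
  refine measure_mono_null ?_ hae
  rintro x ⟨⟨hxU, hgx, -⟩, hx⟩ hcontra
  have h0 : h' x = 0 := by simpa using hcontra ⟨hxU, hgx⟩
  have h1 : l (fderiv ℝ g x w) • w = 0 := by simpa [h'] using congrArg (fun T => T w) h0
  exact (smul_ne_zero hx hw0) h1

/-- A map whose differential is `o(‖y - x‖ ^ k)` varies by `o(‖y - x‖ ^ (k + 1))` near `x`. -/
theorem isLittleO_sub_of_fderiv {E G : Type*} [NormedAddCommGroup E] [NormedSpace ℝ E]
    [NormedAddCommGroup G] [NormedSpace ℝ G] {U : Set E} (hU : IsOpen U) {g : E → G}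
    (hg : DifferentiableOn ℝ g U) {x : E} (hx : x ∈ U) {k : ℕ}
    (h : fderiv ℝ g =o[𝓝 x] fun y => ‖y - x‖ ^ k) :
    (fun y => g y - g x) =o[𝓝 x] fun y => ‖y - x‖ ^ (k + 1) := by
  rw [Asymptotics.isLittleO_iff] at h ⊢
  intro c hc
  obtain ⟨r, hr, hball⟩ := Metric.eventually_nhds_iff_ball.1 ((h hc).and (hU.eventually_mem hx))
  filter_upwards [Metric.ball_mem_nhds x hr] with y hy
  rw [mem_ball_iff_norm] at hy
  have hsub : Metric.closedBall x ‖y - x‖ ⊆ Metric.ball x r := Metric.closedBall_subset_ball hy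
  have := (convex_closedBall x ‖y - x‖).norm_image_sub_le_of_norm_fderiv_le (𝕜 := ℝ) (f := g)
    (C := c * ‖y - x‖ ^ k) (x := x) (y := y)
    (fun z hz => hg.differentiableAt (hU.mem_nhds (hball z (hsub hz)).2))
    (fun z hz => (hball z (hsub hz)).1.trans ?_) (by simp) (by simp [dist_eq_norm])
  · refine this.trans (le_of_eq ?_)
    rw [norm_pow, norm_norm]
    ring
  · rw [norm_pow, norm_norm]
    gcongr
    exact mem_closedBall_iff_norm.1 hz

/-- At almost every zero of a `C^k` map, the map is `o(‖y - x‖ ^ k)`. -/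
theorem measure_zeros_not_isLittleO.{u} {E : Type u} [NormedAddCommGroup E] [NormedSpace ℝ E]
    [FiniteDimensional ℝ E] [MeasurableSpace E] [BorelSpace E] (μ : Measure E) [μ.IsAddHaarMeasure]
    {U : Set E} (hU : IsOpen U) (k : ℕ) : ∀ (G : Type u) [NormedAddCommGroup G] [NormedSpace ℝ G]
    (g : E → G), ContDiffOn ℝ k g U →
    μ {x ∈ U | g x = 0 ∧ ¬ g =o[𝓝 x] fun y => ‖y - x‖ ^ k} = 0 := by
  induction k with
  | zero =>
    intro G _ _ g hg
    convert measure_empty (μ := μ)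
    refine eq_empty_of_forall_notMem fun x hx => hx.2.2 ?_
    simp only [pow_zero]
    rw [Asymptotics.isLittleO_one_iff, ← hx.2.1]
    exact hg.continuousOn.continuousAt (hU.mem_nhds hx.1)
  | succ k ih =>
    intro G _ _ g hg
    have h1 := measure_zeros_fderiv_ne_zero μ hU (hg.of_le (by simp))
    have h2 := ih (E →L[ℝ] G) (fderiv ℝ g) (hg.fderiv_of_isOpen hU (by simp))
    refine measure_mono_null ?_ (measure_union_null h1 h2)
    rintro x ⟨hxU, hgx, hx⟩
    by_cases hd : fderiv ℝ g x = 0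
    · refine Or.inr ⟨hxU, hd, fun ho => hx ?_⟩
      simpa [hgx] using isLittleO_sub_of_fderiv hU (hg.differentiableOn (by simp)) hxU ho
    · exact Or.inl ⟨hxU, hgx, hd⟩

theorem holderOnWith_of_norm_sub_le {E F : Type*} [NormedAddCommGroup E] [NormedAddCommGroup F]
    {f : E → F} {S : Set E} {C : ℝ≥0} {k : ℕ}
    (h : ∀ x ∈ S, ∀ y ∈ S, ‖f x - f y‖ ≤ C * ‖x - y‖ ^ k) : HolderOnWith C k f S := by
  intro x hx y hy
  rw [NNReal.coe_natCast, ENNReal.rpow_natCast, edist_eq_enorm_sub, edist_eq_enorm_sub,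
    enorm_eq_nnnorm, enorm_eq_nnnorm]
  exact_mod_cast h x hx y hy

section Pi

variable {n m k : ℕ}

/-- A Hölder estimate of exponent `k` between spaces of dimensions `n ≤ k m` and `m` bounds the volume
of the image by that of the source, since `k m`-dimensional Hausdorff measure is at most
`n`-dimensional Hausdorff measure. -/
theorem volume_image_le_of_norm_sub_le {f : (Fin n → ℝ) → (Fin m → ℝ)} {S : Set (Fin n → ℝ)}
    {C : ℝ≥0} (hk : k ≠ 0) (hnkm : n ≤ k * m)
    (h : ∀ x ∈ S, ∀ y ∈ S, ‖f x - f y‖ ≤ C * ‖x - y‖ ^ k) :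
    volume (f '' S) ≤ (C : ℝ≥0∞) ^ (m : ℝ) * volume S := by
  have h1 := (holderOnWith_of_norm_sub_le h).hausdorffMeasure_image_le
    (by exact_mod_cast Nat.pos_of_ne_zero hk) (d := m) (by positivity)
  have h2 : Measure.hausdorffMeasure ((k : ℝ≥0) * (m : ℝ)) S
      ≤ Measure.hausdorffMeasure (n : ℝ) S :=
    Measure.hausdorffMeasure_mono (by exact_mod_cast hnkm) S
  have e1 := hausdorffMeasure_pi_real (ι := Fin n)
  have e2 := hausdorffMeasure_pi_real (ι := Fin m)
  rw [Fintype.card_fin] at e1 e2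
  rw [← e1, ← e2]
  exact h1.trans (by gcongr)

/-- If `n ≤ k m`, the set of points where `f` varies by `o(‖y - x‖ ^ k)` has a null image: the Hölder
constant can be taken arbitrarily small on small pieces. -/
theorem volume_image_eq_zero_of_isLittleO {f : (Fin n → ℝ) → (Fin m → ℝ)} {S : Set (Fin n → ℝ)}
    (hk : k ≠ 0) (hm : m ≠ 0) (hnkm : n ≤ k * m)
    (h : ∀ x ∈ S, (fun y => f y - f x) =o[𝓝 x] fun y => ‖y - x‖ ^ k) : volume (f '' S) = 0 := by
  suffices H : ∀ R : ℕ, volume (f '' (S ∩ Metric.ball 0 R)) = 0 by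
    have : S = ⋃ R : ℕ, S ∩ Metric.ball 0 R := by
      rw [← inter_iUnion, Metric.iUnion_ball_nat, inter_univ]
    rw [this, image_iUnion]
    exact measure_iUnion_null H
  intro R
  have hV : volume (Metric.ball (0 : Fin n → ℝ) R) ≠ ⊤ := Metric.isBounded_ball.measure_lt_top.ne
  have key : ∀ ε : ℝ≥0, 0 < ε → volume (f '' (S ∩ Metric.ball 0 R)) ≤
      (ε : ℝ≥0∞) ^ (m : ℝ) * volume (Metric.ball (0 : Fin n → ℝ) R) := by
    intro ε hε
    let Q : ℕ → Set (Fin n → ℝ) := fun j => {x ∈ S ∩ Metric.ball 0 R |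
      ∀ y, ‖y - x‖ < 1 / ((j : ℝ) + 1) → ‖f y - f x‖ ≤ ε * ‖y - x‖ ^ k}
    have hmono : Monotone fun j => f '' Q j := fun i j hij => by
      refine image_mono fun x hx => ⟨hx.1, fun y hy => hx.2 y (hy.trans_le ?_)⟩
      exact one_div_le_one_div_of_le (by positivity) (by exact_mod_cast Nat.succ_le_succ hij)
    have hunion : S ∩ Metric.ball 0 R = ⋃ j, Q j := by
      refine Subset.antisymm (fun x hx => ?_) (iUnion_subset fun j x hx => hx.1)
      obtain ⟨δ, hδ, hball⟩ := Metric.eventually_nhds_iff_ball.1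
        ((Asymptotics.isLittleO_iff.1 (h x hx.1)) (NNReal.coe_pos.2 hε))
      obtain ⟨j, hj⟩ := exists_nat_one_div_lt hδ
      refine mem_iUnion.2 ⟨j, hx, fun y hy => ?_⟩
      simpa using hball y (mem_ball_iff_norm.2 (hy.trans hj))
    rw [hunion, image_iUnion, hmono.measure_iUnion]
    refine iSup_le fun j => ?_
    let δ : ℝ := 1 / ((j : ℝ) + 1)
    have hδ : 0 < δ := by positivity
    -- A countable measurable partition into pieces of diameter less than `δ`.
    let P : ℕ → Set (Fin n → ℝ) :=
      disjointed fun i => Metric.ball (TopologicalSpace.denseSeq (Fin n → ℝ) i) (δ / 2)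
    have hPm : ∀ i, MeasurableSet (P i) := fun i =>
      MeasurableSet.disjointed (fun i => measurableSet_ball) i
    have hPd : Pairwise (Function.onFun Disjoint P) := disjoint_disjointed _
    have hPu : ⋃ i, P i = univ := by
      rw [iUnion_disjointed, eq_univ_iff_forall]
      intro x
      obtain ⟨i, hy⟩ := (TopologicalSpace.denseRange_denseSeq (Fin n → ℝ)).exists_mem_open
        Metric.isOpen_ball ⟨x, Metric.mem_ball_self (half_pos hδ)⟩
      exact mem_iUnion.2 ⟨i, Metric.mem_ball_comm.1 hy⟩
    have hPδ : ∀ i, ∀ x ∈ P i, ∀ y ∈ P i, ‖x - y‖ < δ := fun i x hx y hy => by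
      have hx' := disjointed_subset _ _ hx
      have hy' := disjointed_subset _ _ hy
      rw [← dist_eq_norm]
      linarith [dist_triangle_right x y (TopologicalSpace.denseSeq (Fin n → ℝ) i),
        Metric.mem_ball.1 hx', Metric.mem_ball.1 hy']
    calc volume (f '' Q j) ≤ volume (⋃ i, f '' (Q j ∩ P i)) := by
          rw [← image_iUnion, ← inter_iUnion, hPu, inter_univ]
      _ ≤ ∑' i, volume (f '' (Q j ∩ P i)) := measure_iUnion_le _
      _ ≤ ∑' i, (ε : ℝ≥0∞) ^ (m : ℝ) * volume (Metric.ball (0 : Fin n → ℝ) R ∩ P i) := by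
          refine ENNReal.tsum_le_tsum fun i => ?_
          refine (volume_image_le_of_norm_sub_le hk hnkm (C := ε) fun x hx y hy => ?_).trans ?_
          · exact hy.1.2 x (hPδ i x hx.2 y hy.2)
          · gcongr
            exact fun x hx => hx.1.2
      _ = (ε : ℝ≥0∞) ^ (m : ℝ) * volume (⋃ i, Metric.ball (0 : Fin n → ℝ) R ∩ P i) := by
          rw [ENNReal.tsum_mul_left, measure_iUnion
            (fun i j hij => (hPd hij).mono inter_subset_right inter_subset_right)
            (fun i => measurableSet_ball.inter (hPm i))]
      _ = (ε : ℝ≥0∞) ^ (m : ℝ) * volume (Metric.ball (0 : Fin n → ℝ) R) := by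
          rw [← inter_iUnion, hPu, inter_univ]
  have hlim : Tendsto (fun ε : ℝ≥0 => (ε : ℝ≥0∞) ^ (m : ℝ) *
      volume (Metric.ball (0 : Fin n → ℝ) R)) (𝓝[>] 0) (𝓝 0) := by
    have h1 : Tendsto (fun ε : ℝ≥0 => (ε : ℝ≥0∞) ^ (m : ℝ)) (𝓝[>] 0) (𝓝 0) := by
      have h2 : Continuous fun ε : ℝ≥0 => (ε : ℝ≥0∞) ^ (m : ℝ) :=
        ENNReal.continuous_rpow_const.comp ENNReal.continuous_coe
      have h3 := (h2.tendsto 0).mono_left (nhdsWithin_le_nhds (s := Ioi 0))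
      rwa [ENNReal.coe_zero, ENNReal.zero_rpow_of_pos
        (by exact_mod_cast Nat.pos_of_ne_zero hm)] at h3
    simpa using ENNReal.Tendsto.mul_const h1 (Or.inr hV)
  refine le_antisymm (ge_of_tendsto hlim ?_) (zero_le)
  filter_upwards [self_mem_nhdsWithin] with ε hε
  exact key ε hε

/-- The image of a set `A` of points of rank zero under a `C^k` map is a null set if `n ≤ k m`.
At almost all points of `A` the map varies by `o(‖y - x‖ ^ k)`. On the remaining null set, Morse's
decomposition provides Hölder estimates of exponent `k`, and these preserve null sets. -/
theorem volume_image_eq_zero_of_fderiv_eq_zero {U A : Set (Fin n → ℝ)} (hU : IsOpen U)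
    {f : (Fin n → ℝ) → (Fin m → ℝ)} (hf : ContDiffOn ℝ k f U) (hk : k ≠ 0) (hm : m ≠ 0)
    (hnkm : n ≤ k * m) (hA : A ⊆ U) (hfA : ∀ x ∈ A, fderiv ℝ f x = 0) :
    volume (f '' A) = 0 := by
  obtain ⟨k, rfl⟩ := Nat.exists_eq_succ_of_ne_zero hk
  have hdiff : DifferentiableOn ℝ f U := hf.differentiableOn (by simp)
  have hf' : ContDiffOn ℝ k (fderiv ℝ f) U := hf.fderiv_of_isOpen hU (by simp)
  set N : Set (Fin n → ℝ) :=
    {x ∈ U | fderiv ℝ f x = 0 ∧ ¬ fderiv ℝ f =o[𝓝 x] fun y => ‖y - x‖ ^ k} with hN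
  have hN0 : volume N = 0 := measure_zeros_not_isLittleO volume hU k _ _ hf'
  obtain ⟨T, hTc, hcov, hT⟩ :=
    isSigmaFlat_of_contDiffOn k n _ _ U A (fderiv ℝ f) (by simp) hU hf' hA hfA
  have h1 : volume (⋃ S ∈ T, f '' (S ∩ N)) = 0 := by
    refine (measure_biUnion_null_iff hTc).2 fun S hS => ?_
    obtain ⟨C, hC, h⟩ := (hT S hS).of_fderiv hU hdiff
    have hle : ∀ x ∈ S ∩ N, ∀ y ∈ S ∩ N, ‖f x - f y‖ ≤ (⟨C, hC⟩ : ℝ≥0) * ‖x - y‖ ^ (k + 1) := by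
      intro x hx y hy
      obtain ⟨γ, γ', h0, h1, hγ⟩ := h x hx.1 y hy.1
      have := (hγ 1 (right_mem_Icc.2 zero_le_one)).2.2.2
      rwa [h1, norm_sub_rev] at this
    refine le_antisymm ((volume_image_le_of_norm_sub_le hk hnkm hle).trans ?_) (zero_le)
    rw [measure_mono_null inter_subset_right hN0, mul_zero]
  have h2 : volume (f '' (A \ N)) = 0 := by
    refine volume_image_eq_zero_of_isLittleO hk hm hnkm fun x hx => ?_
    refine isLittleO_sub_of_fderiv hU hdiff (hA hx.1) ?_
    by_contra ho
    exact hx.2 ⟨hA hx.1, hfA x hx.1, ho⟩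
  refine measure_mono_null ?_ (measure_union_null h1 h2)
  rintro _ ⟨x, hx, rfl⟩
  by_cases hxN : x ∈ N
  · obtain ⟨S, hS, hxS⟩ := hcov hx
    exact Or.inl (mem_iUnion₂.2 ⟨S, hS, mem_image_of_mem f ⟨hxS, hxN⟩⟩)
  · exact Or.inr (mem_image_of_mem f ⟨hx, hxN⟩)

end Pi

/-- Coordinate-free form of `volume_image_eq_zero_of_fderiv_eq_zero`. -/
theorem addHaar_image_eq_zero_of_fderiv_eq_zero {E F : Type*} [NormedAddCommGroup E]
    [NormedSpace ℝ E] [FiniteDimensional ℝ E] [NormedAddCommGroup F] [NormedSpace ℝ F]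
    [FiniteDimensional ℝ F] [MeasurableSpace F] [BorelSpace F] (μ : Measure F) [μ.IsAddHaarMeasure]
    {k : ℕ} {U A : Set E} (hU : IsOpen U) {f : E → F} (hf : ContDiffOn ℝ k f U) (hk : k ≠ 0)
    (hm : Module.finrank ℝ F ≠ 0) (hkm : Module.finrank ℝ E ≤ k * Module.finrank ℝ F)
    (hA : A ⊆ U) (hfA : ∀ x ∈ A, fderiv ℝ f x = 0) : μ (f '' A) = 0 := by
  let a : (Fin (Module.finrank ℝ E) → ℝ) ≃L[ℝ] E := ContinuousLinearEquiv.ofFinrankEq (by simp)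
  let b : F ≃L[ℝ] (Fin (Module.finrank ℝ F) → ℝ) := ContinuousLinearEquiv.ofFinrankEq (by simp)
  have hcomp : ContDiffOn ℝ k (fun x => b (f (a x))) (a ⁻¹' U) :=
    b.contDiff.comp_contDiffOn (hf.comp a.contDiff.contDiffOn fun x hx => hx)
  have h0 : volume ((fun x => b (f (a x))) '' (a ⁻¹' A)) = 0 := by
    refine volume_image_eq_zero_of_fderiv_eq_zero (hU.preimage a.continuous) hcomp hk hm hkm
      (fun x hx => hA hx) fun x hx => ?_
    have hd : DifferentiableAt ℝ f (a x) :=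
      (hf.differentiableOn (by exact_mod_cast hk)).differentiableAt (hU.mem_nhds (hA hx))
    have h1 : HasFDerivAt f (0 : E →L[ℝ] F) (a x) := by
      have := hd.hasFDerivAt
      rwa [hfA (a x) hx] at this
    have h2 := b.hasFDerivAt.comp x (h1.comp x a.hasFDerivAt)
    simpa using! h2.fderiv
  have himg : (fun x => b (f (a x))) '' (a ⁻¹' A) = b '' (f '' A) := by
    rw [image_image]
    ext y
    constructor
    · rintro ⟨x, hx, rfl⟩
      exact ⟨a x, hx, rfl⟩
    · rintro ⟨x, hx, rfl⟩
      exact ⟨a.symm x, by simpa using hx, by simp⟩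
  have : (Measure.map b μ).IsAddHaarMeasure := b.isAddHaarMeasure_map μ
  have h3 : Measure.map b μ (b '' (f '' A)) = 0 := by
    rw [← himg]
    exact Measure.absolutelyContinuous_isAddHaarMeasure _ volume h0
  have h4 : Measure.map b.toHomeomorph.toMeasurableEquiv μ (b '' (f '' A)) = 0 := h3
  rw [MeasurableEquiv.map_apply] at h4
  have h5 : b.toHomeomorph.toMeasurableEquiv ⁻¹' (b '' (f '' A)) = f '' A :=
    b.injective.preimage_image _
  rwa [h5] at h4

/-! ### Haar-null sets -/

/-- Some nonzero finite measure with compact support vanishes on all translates of `B`. -/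
def HasNullTranslates {X : Type*} [NormedAddCommGroup X] [MeasurableSpace X] (B : Set X) : Prop :=
  ∃ μ : Measure X, IsFiniteMeasure μ ∧ μ ≠ 0 ∧ (∃ K : Set X, IsCompact K ∧ μ Kᶜ = 0) ∧
    ∀ x : X, μ ((fun b => x + b) '' B) = 0

section HaarNull

variable {X : Type*} [NormedAddCommGroup X] [MeasurableSpace X]

theorem measurableSet_add_image [BorelSpace X] {B : Set X} (hB : MeasurableSet B) (x : X) :
    MeasurableSet ((fun b => x + b) '' B) := by
  rw [image_add_left]
  exact (measurable_const_add (-x)) hB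

variable [TopologicalSpace.SeparableSpace X]

theorem exists_measure_closedBall_ne_zero {μ : Measure X} (hμ : μ ≠ 0) {ε : ℝ} (hε : 0 < ε) :
    ∃ c, μ (Metric.closedBall c ε) ≠ 0 := by
  by_contra! h
  refine hμ (Measure.measure_univ_eq_zero.1 ?_)
  have : (univ : Set X) = ⋃ i, Metric.closedBall (TopologicalSpace.denseSeq X i) ε := by
    refine (eq_univ_iff_forall.2 fun x => ?_).symm
    obtain ⟨i, hi⟩ := (TopologicalSpace.denseRange_denseSeq X).exists_mem_open
      Metric.isOpen_ball ⟨x, Metric.mem_ball_self hε⟩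
    exact mem_iUnion.2 ⟨i, Metric.ball_subset_closedBall (Metric.mem_ball_comm.1 hi)⟩
  rw [this]
  exact measure_iUnion_null fun i => h _

/-- A ball has a translate of positive measure, for every nonzero measure on a separable space. -/
theorem HasNullTranslates.dense_compl {B : Set X} (h : HasNullTranslates B) : Dense Bᶜ := by
  rw [← interior_eq_empty_iff_dense_compl, eq_empty_iff_forall_notMem]
  intro z hz
  obtain ⟨μ, -, hμ, -, hnull⟩ := h
  obtain ⟨ε, hε, hball⟩ := Metric.nhds_basis_closedBall.mem_iff.1 (mem_interior_iff_mem_nhds.1 hz)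
  obtain ⟨c, hc⟩ := exists_measure_closedBall_ne_zero hμ hε
  refine hc (measure_mono_null (fun y hy => ?_) (hnull (c - z)))
  refine ⟨y - c + z, hball ?_, by simp⟩
  rw [mem_closedBall_iff_norm] at hy ⊢
  simpa using hy

variable [BorelSpace X]

/-- The test measure of a set can be taken to be a probability measure near the origin. -/
theorem HasNullTranslates.exists_isProbabilityMeasure {B : Set X} (hB : MeasurableSet B)
    (h : HasNullTranslates B) {ε : ℝ} (hε : 0 < ε) :
    ∃ (ν : Measure X) (K : Set X), IsProbabilityMeasure ν ∧ IsCompact K ∧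
      K ⊆ Metric.closedBall 0 ε ∧ ν Kᶜ = 0 ∧ ∀ x : X, ν ((fun b => x + b) '' B) = 0 := by
  obtain ⟨μ, hfin, hμ, ⟨K, hK, hμK⟩, hnull⟩ := h
  obtain ⟨c, hc⟩ := exists_measure_closedBall_ne_zero hμ hε
  set s := Metric.closedBall c ε with hs
  have hprob : IsProbabilityMeasure (ProbabilityTheory.cond μ s) :=
    ProbabilityTheory.cond_isProbabilityMeasure hc
  have hm : Measurable fun y : X => y - c := measurable_sub_const c
  have hK' : IsCompact ((fun y => y - c) '' (K ∩ s)) :=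
    (hK.inter_right Metric.isClosed_closedBall).image (by fun_prop)
  refine ⟨(ProbabilityTheory.cond μ s).map (fun y => y - c), (fun y => y - c) '' (K ∩ s),
    Measure.isProbabilityMeasure_map hm.aemeasurable, hK', ?_, ?_, fun x => ?_⟩
  · rintro _ ⟨y, hy, rfl⟩
    rw [mem_closedBall_zero_iff]
    exact mem_closedBall_iff_norm.1 hy.2
  · rw [Measure.map_apply hm hK'.isClosed.measurableSet.compl,
      ProbabilityTheory.cond_apply Metric.isClosed_closedBall.measurableSet]
    refine mul_eq_zero_of_right _ (measure_mono_null ?_ hμK)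
    rintro y ⟨hys, hy⟩ hyK
    exact hy ⟨y, ⟨hyK, hys⟩, rfl⟩
  · rw [Measure.map_apply hm (measurableSet_add_image hB x)]
    refine ProbabilityTheory.cond_absolutelyContinuous (measure_mono_null ?_ (hnull (x + c)))
    rintro y ⟨b, hb, hby⟩
    refine ⟨b, hb, ?_⟩
    have : x + b = y - c := hby
    calc x + c + b = (x + b) + c := by abel
      _ = y := by rw [this, sub_add_cancel]

/-- Resampling one coordinate does not change an infinite product measure. -/
theorem map_update_prod_infinitePi {ι : Type*} [DecidableEq ι] {Z : ι → Type*}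
    [∀ i, MeasurableSpace (Z i)] (ν : ∀ i, Measure (Z i)) [∀ i, IsProbabilityMeasure (ν i)]
    (n : ι) : Measurable (fun p : (∀ i, Z i) × Z n => Function.update p.1 n p.2) ∧
      ((Measure.infinitePi ν).prod (ν n)).map (fun p => Function.update p.1 n p.2) =
        Measure.infinitePi ν := by
  have hm : Measurable (fun p : (∀ i, Z i) × Z n => Function.update p.1 n p.2) := by
    refine measurable_pi_iff.2 fun i => ?_
    by_cases h : i = n
    · subst h
      simpa using measurable_snd
    · simp only [Function.update_of_ne h]
      exact (measurable_pi_apply i).comp measurable_fst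
  refine ⟨hm, Measure.eq_infinitePi ν fun s t ht => ?_⟩
  have hst : MeasurableSet (Set.pi (s : Set ι) t) :=
    MeasurableSet.pi s.countable_toSet fun i _ => ht i
  rw [Measure.map_apply hm hst]
  have hpre : (fun p : (∀ i, Z i) × Z n => Function.update p.1 n p.2) ⁻¹' Set.pi (s : Set ι) t =
      Set.pi ((s.erase n : Finset ι) : Set ι) t ×ˢ (if n ∈ s then t n else univ) := by
    ext ⟨z, a⟩
    simp only [mem_preimage, Set.mem_pi, Finset.mem_coe, mem_prod, Finset.mem_erase]
    constructor
    · intro h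
      refine ⟨fun i hi => ?_, ?_⟩
      · simpa [Function.update_of_ne hi.1] using h i hi.2
      · split_ifs with hn
        · simpa using h n hn
        · trivial
    · rintro ⟨h1, h2⟩ i hi
      by_cases hin : i = n
      · subst hin
        simpa [hi] using h2
      · simpa [Function.update_of_ne hin] using h1 i ⟨hin, hi⟩
  rw [hpre, Measure.prod_prod, Measure.infinitePi_pi _ fun i _ => ht i]
  split_ifs with hn
  · rw [Finset.prod_erase_mul _ _ hn]
  · rw [Finset.erase_eq_of_notMem hn, measure_univ, mul_one]

variable [CompleteSpace X]

/-- A countable union of Borel sets with null translates has null translates: the sum of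
independent small random vectors distributed according to the test measures of the given sets
is a test measure of the union. -/
theorem HasNullTranslates.iUnion {B : ℕ → Set X} (hB : ∀ n, MeasurableSet (B n))
    (h : ∀ n, HasNullTranslates (B n)) : HasNullTranslates (⋃ n, B n) := by
  have : SecondCountableTopology X := UniformSpace.secondCountable_of_separable X
  have hpow : ∀ n : ℕ, (0 : ℝ) < (1 / 2) ^ n := fun n => by positivity
  choose ν K hν hK hKb hνK hnull using fun n => (h n).exists_isProbabilityMeasure (hB n) (hpow n)
  have hKm : ∀ n, MeasurableSet (K n) := fun n => (hK n).isClosed.measurableSet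
  let ν' : ∀ n, Measure (K n) := fun n => (ν n).comap Subtype.val
  have hν' : ∀ n, IsProbabilityMeasure (ν' n) := fun n => ⟨by
    have := measure_univ (μ := ν n)
    rw [← measure_add_measure_compl (hKm n), hνK n, add_zero] at this
    rw [(MeasurableEmbedding.subtype_coe (hKm n)).comap_apply, image_univ, Subtype.range_coe]
    exact this⟩
  have hKc : ∀ n, CompactSpace (K n) := fun n => isCompact_iff_compactSpace.1 (hK n)
  have hbd : ∀ n (a : K n), ‖(a : X)‖ ≤ (1 / 2) ^ n := fun n a =>
    mem_closedBall_zero_iff.1 (hKb n a.2)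
  have hsum : ∀ z : ∀ n, K n, Summable fun n => (z n : X) := fun z =>
    .of_norm_bounded summable_geometric_two fun n => hbd n (z n)
  let S : (∀ n, K n) → X := fun z => ∑' n, (z n : X)
  have hS : Continuous S :=
    continuous_tsum (fun n => continuous_subtype_val.comp (continuous_apply n))
      summable_geometric_two fun n z => hbd n (z n)
  have hSm : Measurable S := hS.measurable
  let P := Measure.infinitePi ν'
  refine ⟨P.map S, inferInstance, ?_, ⟨range S, isCompact_range hS, ?_⟩, fun x => ?_⟩
  · have : IsProbabilityMeasure (P.map S) := Measure.isProbabilityMeasure_map hSm.aemeasurable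
    exact IsProbabilityMeasure.ne_zero _
  · rw [Measure.map_apply hSm (isCompact_range hS).isClosed.measurableSet.compl]
    convert measure_empty (μ := P)
    ext z
    simp
  · rw [image_iUnion]
    refine measure_iUnion_null fun n => ?_
    set D := (fun b => x + b) '' B n with hD
    have hDm : MeasurableSet D := measurableSet_add_image (hB n) x
    obtain ⟨hum, hu⟩ := map_update_prod_infinitePi ν' n
    rw [Measure.map_apply hSm hDm, show P = _ from hu.symm, Measure.map_apply hum (hSm hDm),
      Measure.measure_prod_null (hum (hSm hDm))]
    refine Eventually.of_forall fun z => ?_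
    -- The sum depends on its `n`-th term by translation, and that term is independent of the others.
    have hupd : ∀ a : K n, S (Function.update z n a) = a - z n + S z := fun a => by
      have h1 := (hsum z).hasSum.update n (a : X)
      have h2 : Function.update (fun i => (z i : X)) n (a : X) =
          fun i => (Function.update z n a i : X) := by
        ext i
        by_cases hi : i = n
        · subst hi
          simp
        · simp [Function.update_of_ne hi]
      rw [h2] at h1
      exact h1.tsum_eq
    refine ((MeasurableEmbedding.subtype_coe (hKm n)).comap_apply (ν n) _).trans ?_
    refine measure_mono_null ?_ (hnull n (x + z n - S z))
    rintro _ ⟨a, ha, rfl⟩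
    obtain ⟨b, hb, hba⟩ : S (Function.update z n a) ∈ D := ha
    refine ⟨b, hb, ?_⟩
    have h3 : x + b = a - z n + S z := hba.trans (hupd a)
    calc x + z n - S z + b = (x + b) + z n - S z := by abel
      _ = a := by rw [h3]; abel

end HaarNull

theorem hasNullTranslates_empty {X : Type*} [NormedAddCommGroup X] [MeasurableSpace X]
    [BorelSpace X] : HasNullTranslates (∅ : Set X) :=
  ⟨Measure.dirac 0, inferInstance, IsProbabilityMeasure.ne_zero _,
    ⟨{0}, isCompact_singleton, by simp⟩, fun x => by simp⟩

/-! ### Local structure of Fredholm maps -/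

section Linear

variable {E Y : Type*} [AddCommGroup E] [Module ℝ E] [AddCommGroup Y] [Module ℝ Y]
  {D : E →ₗ[ℝ] Y} {q : Y →ₗ[ℝ] E}

/-- If `q` is a generalized inverse of `D`, then `ker q` is a complement of the range of `D`. -/
theorem nonempty_quotient_range_equiv_ker (hDq : ∀ x, D (q (D x)) = D x)
    (hqD : ∀ y, q (D (q y)) = q y) : Nonempty ((Y ⧸ D.range) ≃ₗ[ℝ] q.ker) := by
  let σ : Y →ₗ[ℝ] q.ker := (LinearMap.id - D ∘ₗ q).codRestrict q.ker fun y => by simp [hqD]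
  have hσ : Function.Surjective σ := fun y => ⟨y, by
    ext
    simp [σ]⟩
  have hker : σ.ker = D.range := by
    ext y
    simp only [σ, LinearMap.ker_codRestrict, LinearMap.mem_ker, LinearMap.sub_apply,
      LinearMap.id_apply, LinearMap.comp_apply, LinearMap.mem_range]
    constructor
    · intro h
      exact ⟨q y, (sub_eq_zero.1 h).symm⟩
    · rintro ⟨x, rfl⟩
      rw [hDq, sub_self]
  exact ⟨(Submodule.quotEquivOfEq _ _ hker.symm).trans (σ.quotKerEquivOfSurjective hσ)⟩

variable {A : E →ₗ[ℝ] Y} {b : E ≃ₗ[ℝ] E}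

/-- If `A` and `D` agree up to an automorphism of the source after composition with a Fredholm
operator, they have the same index. -/
theorem index_eq_of_comp_eq [FiniteDimensional ℝ q.ker] [FiniteDimensional ℝ (E ⧸ q.range)]
    [FiniteDimensional ℝ D.ker] [FiniteDimensional ℝ (Y ⧸ D.range)]
    [FiniteDimensional ℝ A.ker] [FiniteDimensional ℝ (Y ⧸ A.range)]
    (h : ∀ x, q (A x) = q (D (b x))) : A.index = D.index := by
  have hb1 : FiniteDimensional ℝ b.toLinearMap.ker := by
    rw [LinearEquiv.ker]
    infer_instance
  have hDbk : FiniteDimensional ℝ (D ∘ₗ b.toLinearMap).ker := by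
    rw [LinearMap.ker_comp]
    infer_instance
  have hb2 : b.toLinearMap.range = ⊤ := LinearEquiv.range b
  have hb3 : FiniteDimensional ℝ (E ⧸ b.toLinearMap.range) := by
    rw [hb2]
    infer_instance
  have hDbr : (D ∘ₗ b.toLinearMap).range = D.range := LinearMap.range_comp_of_range_eq_top _ hb2
  have hDbr' : FiniteDimensional ℝ (Y ⧸ (D ∘ₗ b.toLinearMap).range) := by
    rw [hDbr]
    infer_instance
  have h1 : q ∘ₗ A = q ∘ₗ (D ∘ₗ b.toLinearMap) := LinearMap.ext h
  have h2 := LinearMap.index_comp (f := A) q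
  rw [h1, LinearMap.index_comp, LinearMap.index_comp, LinearEquiv.index_eq_zero] at h2
  lia

/-- Suppose that `A` and `D` agree up to an automorphism `b` of the source after composition with a
generalized inverse `q` of `D`. Then `b` maps `ker A` into `ker D`, and if moreover `A` and `D` have
the same index and cokernels of the same dimension, it maps `ker A` onto `ker D`. -/
theorem apply_eq_zero_of_comp_eq (hDq : ∀ x, D (q (D x)) = D x) [FiniteDimensional ℝ D.ker]
    (hindex : A.index = D.index)
    (hcoker : Module.finrank ℝ (Y ⧸ A.range) = Module.finrank ℝ (Y ⧸ D.range))
    (h : ∀ x, q (A x) = q (D (b x))) {x : E} (hx : D (b x) = 0) : A x = 0 := by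
  have hle : A.ker.map b.toLinearMap ≤ D.ker := by
    rintro _ ⟨y, hy, rfl⟩
    have h1 : q (A y) = 0 := by rw [LinearMap.mem_ker.1 hy, map_zero]
    rw [LinearMap.mem_ker]
    change D (b y) = 0
    rw [← hDq, ← h, h1, map_zero]
  have hrank : Module.finrank ℝ (A.ker.map b.toLinearMap) = Module.finrank ℝ D.ker := by
    rw [LinearEquiv.finrank_map_eq]
    rw [LinearMap.index_eq_finrank_sub, LinearMap.index_eq_finrank_sub] at hindex
    lia
  have heq := Submodule.eq_of_le_of_finrank_eq hle hrank
  have hmem : b x ∈ A.ker.map b.toLinearMap := heq ▸ LinearMap.mem_ker.2 hx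
  obtain ⟨y, hy, hyx⟩ := hmem
  rw [← b.injective hyx]
  exact hy

end Linear

/-- A Fredholm operator has a continuous generalized inverse `q`: `D q D = D` and `q D q = q`. -/
theorem exists_generalizedInverse {E Y : Type*} [NormedAddCommGroup E] [NormedSpace ℝ E]
    [NormedAddCommGroup Y] [NormedSpace ℝ Y] {D : E →L[ℝ] Y} (hD : D.IsFredholm) :
    ∃ q : Y →L[ℝ] E, (∀ x, D (q (D x)) = D x) ∧ ∀ y, q (D (q y)) = q y := by
  obtain ⟨pkg⟩ := hD.nonempty_fredholmPackage
  have hD' : ∀ x, D x = pkg.equiv (pkg.decDom.proj x) := fun x => by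
    conv_lhs => rw [pkg.eq_equiv]
    rfl
  have hq' : ∀ y, pkg.quasiInverse y = pkg.equiv.symm (pkg.decCodom.proj y) := fun y => rfl
  refine ⟨pkg.quasiInverse, fun x => ?_, fun y => ?_⟩
  · simp only [hD', hq', FredholmDecomposition.proj, Submodule.projectionOntoL_apply_left,
      ContinuousLinearEquiv.symm_apply_apply]
  · simp only [hD', hq', FredholmDecomposition.proj, Submodule.projectionOntoL_apply_left,
      ContinuousLinearEquiv.apply_symm_apply]

theorem Submodule.CoFG.finiteDimensional_quotient {Y : Type*} [AddCommGroup Y] [Module ℝ Y]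
    {S : Submodule ℝ Y} (hS : S.CoFG) : FiniteDimensional ℝ (Y ⧸ S) :=
  hS

theorem ContinuousLinearMap.IsFredholm.finiteDimensional_of_generalizedInverse
    {E Y : Type*} [NormedAddCommGroup E] [NormedSpace ℝ E]
    [NormedAddCommGroup Y] [NormedSpace ℝ Y] {D : E →L[ℝ] Y} (hD : D.IsFredholm) {q : Y →L[ℝ] E}
    (hDq : ∀ x, D (q (D x)) = D x) (hqD : ∀ y, q (D (q y)) = q y) :
    FiniteDimensional ℝ D.ker ∧ FiniteDimensional ℝ (Y ⧸ D.range) ∧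
      FiniteDimensional ℝ q.ker ∧ FiniteDimensional ℝ (E ⧸ q.range) := by
  have h1 := hD.finite_ker
  have h2 := hD.finite_coker.finiteDimensional_quotient
  obtain ⟨e⟩ := nonempty_quotient_range_equiv_ker (D := D.toLinearMap) (q := q.toLinearMap) hDq hqD
  obtain ⟨e'⟩ := nonempty_quotient_range_equiv_ker (D := q.toLinearMap) (q := D.toLinearMap) hqD hDq
  exact ⟨h1, h2, e.finiteDimensional, e'.symm.finiteDimensional⟩

/-- A closed set whose translates meet some finite-dimensional subspace in Lebesgue null sets has null
translates: the test measure is Lebesgue measure on the unit ball of the subspace. -/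
theorem hasNullTranslates_of_addHaar {Y : Type*} [NormedAddCommGroup Y] [NormedSpace ℝ Y]
    [MeasurableSpace Y] [BorelSpace Y] {Z : Set Y} (hZ : IsClosed Z) (Y₀ : Submodule ℝ Y)
    [FiniteDimensional ℝ Y₀]
    (h : ∀ x : Y, (Measure.addHaar : Measure Y₀) {y | ∃ b ∈ Z, x + b = y} = 0) :
    HasNullTranslates Z := by
  have : ProperSpace Y₀ := FiniteDimensional.proper ℝ Y₀
  have hval : Measurable (Subtype.val : Y₀ → Y) := measurable_subtype_coe
  set ν : Measure Y₀ := Measure.addHaar.restrict (Metric.closedBall 0 1) with hν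
  have hK : IsCompact (Subtype.val '' Metric.closedBall (0 : Y₀) 1) :=
    (isCompact_closedBall _ _).image continuous_subtype_val
  have hfin : IsFiniteMeasure ν := ⟨by
    rw [hν, Measure.restrict_apply_univ]
    exact (isCompact_closedBall _ _).measure_lt_top⟩
  refine ⟨ν.map Subtype.val, inferInstance, ?_, ⟨_, hK, ?_⟩, fun x => ?_⟩
  · intro h0
    have h1 : (ν.map Subtype.val) univ = 0 := by rw [h0]; rfl
    rw [Measure.map_apply hval MeasurableSet.univ, preimage_univ, hν,
      Measure.restrict_apply_univ] at h1
    exact (Metric.measure_closedBall_pos _ _ one_pos).ne' h1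
  · rw [Measure.map_apply hval hK.isClosed.measurableSet.compl, hν, Measure.restrict_apply
      (hval hK.isClosed.measurableSet.compl)]
    convert measure_empty (μ := (Measure.addHaar : Measure Y₀))
    ext y
    simp only [mem_inter_iff, mem_preimage, mem_compl_iff, mem_empty_iff_false, iff_false, not_and]
    exact fun h1 h2 => h1 ⟨y, h2, rfl⟩
  · rw [Measure.map_apply hval (measurableSet_add_image hZ.measurableSet x)]
    exact Measure.restrict_le_self.absolutelyContinuous (h x)

section Local

variable {E Y : Type*} [NormedAddCommGroup E] [NormedSpace ℝ E] [CompleteSpace E]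
  [NormedAddCommGroup Y] [NormedSpace ℝ Y]

/-- Local structure of a Fredholm map `F`, where `q` is a generalized inverse of the differential
of `F` at `x₀`: in the coordinates `Φ`, with inverse `Ψ`, the map is linear up to its component in
the finite-dimensional space `ker q`. The automorphism `b` is the differential of `Φ` at `x`. -/
theorem exists_fredholm_coordinates {k : ℕ} (hk : k ≠ 0) {U : Set E} (hU : IsOpen U) {F : E → Y}
    (hF : ContDiffOn ℝ k F U) {x₀ : E} (hx₀ : x₀ ∈ U) {q : Y →L[ℝ] E}
    (hqD : ∀ y, q (fderiv ℝ F x₀ (q y)) = q y) :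
    ∃ (Φ Ψ : E → E) (r : ℝ) (N : Set E), 0 < r ∧ IsOpen N ∧ x₀ ∈ N ∧
      Φ x₀ = x₀ ∧ ContinuousOn Φ N ∧ ContDiffOn ℝ k (F ∘ Ψ) (Metric.ball x₀ r) ∧
      (∀ ξ ∈ Metric.ball x₀ r, q (F (Ψ ξ) - F x₀) = q (fderiv ℝ F x₀ (ξ - x₀))) ∧
      ∀ x ∈ N, Φ x ∈ Metric.ball x₀ r ∧ Ψ (Φ x) = x ∧ ∃ b : E ≃ₗ[ℝ] E,
        (∀ v, q (fderiv ℝ F x v) = q (fderiv ℝ F x₀ (b v))) ∧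
        ∀ v, fderiv ℝ (F ∘ Ψ) (Φ x) v = fderiv ℝ F x (b.symm v) := by
  have hk' : (k : WithTop ℕ∞) ≠ 0 := by exact_mod_cast hk
  have hdF : ∀ x ∈ U, HasFDerivAt F (fderiv ℝ F x) x := fun x hx =>
    ((hF.differentiableOn hk').differentiableAt (hU.mem_nhds hx)).hasFDerivAt
  set D := fderiv ℝ F x₀ with hD
  -- Chosen so that `q D (Φ x - x₀) = q (F x - F x₀)`.
  set Φ : E → E := fun x => x + q (F x - F x₀ - D (x - x₀)) with hΦdef
  have hΦ : ContDiffOn ℝ k Φ U := by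
    refine contDiffOn_id.add (q.contDiff.comp_contDiffOn ((hF.sub contDiffOn_const).sub ?_))
    exact (D.contDiff.comp (contDiff_id.sub contDiff_const)).contDiffOn
  have hdΦ : ∀ x ∈ U, HasFDerivAt Φ
      (ContinuousLinearMap.id ℝ E + q ∘L (fderiv ℝ F x - D)) x := fun x hx =>
    (hasFDerivAt_id x).add (q.hasFDerivAt.comp x (((hdF x hx).sub_const _).sub
      (D.hasFDerivAt.comp x ((hasFDerivAt_id x).sub_const x₀))))
  have hΦx₀ : Φ x₀ = x₀ := by simp [hΦdef]
  have hid : HasFDerivAt Φ (ContinuousLinearMap.id ℝ E) x₀ := by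
    simpa [← hD] using hdΦ x₀ hx₀
  have hqΦ : ∀ x, q (D (Φ x - x₀)) = q (F x - F x₀) := fun x => by
    have : Φ x - x₀ = (x - x₀) + q (F x - F x₀ - D (x - x₀)) := by
      simp only [hΦdef]
      abel
    rw [this, map_add, map_add, hqD, map_sub q _ (D (x - x₀))]
    abel
  obtain ⟨Ψ, r, N, K, hr, -, hNo, hxN, hNU, hΨ, hball, hN, -⟩ :=
    exists_localInverse_of_hasFDerivAt_id hk hU hx₀ hΦ hid
  rw [hΦx₀] at hΨ hball hN
  have hdΨ : ∀ ξ ∈ Metric.ball x₀ r, HasFDerivAt Ψ (fderiv ℝ Ψ ξ) ξ := fun ξ hξ =>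
    ((hΨ.differentiableOn hk').differentiableAt (Metric.isOpen_ball.mem_nhds hξ)).hasFDerivAt
  refine ⟨Φ, Ψ, r, N, hr, hNo, hxN, hΦx₀, hΦ.continuousOn.mono hNU,
    hF.comp hΨ fun ξ hξ => (hball ξ hξ).1, fun ξ hξ => ?_, fun x hx => ?_⟩
  · rw [← hqΦ, (hball ξ hξ).2.1]
  have hξ := (hN x hx).1
  have hΨΦ := (hN x hx).2
  set B := ContinuousLinearMap.id ℝ E + q ∘L (fderiv ℝ F x - D) with hB
  have hdx : HasFDerivAt Φ B x := hdΦ x (hNU hx)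
  have h1 : (fderiv ℝ Ψ (Φ x)) ∘L B = ContinuousLinearMap.id ℝ E := by
    refine ((hdΨ _ hξ).comp x hdx).unique ((hasFDerivAt_id x).congr_of_eventuallyEq ?_)
    filter_upwards [hNo.mem_nhds hx] with y hy
    exact (hN y hy).2
  have h2 : B ∘L (fderiv ℝ Ψ (Φ x)) = ContinuousLinearMap.id ℝ E := by
    have hdx' : HasFDerivAt Φ B (Ψ (Φ x)) := by rwa [hΨΦ]
    refine (hdx'.comp _ (hdΨ _ hξ)).unique ((hasFDerivAt_id _).congr_of_eventuallyEq ?_)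
    filter_upwards [Metric.isOpen_ball.mem_nhds hξ] with y hy
    exact (hball y hy).2.1
  refine ⟨hξ, hΨΦ, LinearEquiv.ofLinearMap B.toLinearMap (fderiv ℝ Ψ (Φ x)).toLinearMap
    (LinearMap.ext fun v => congrArg (fun T : E →L[ℝ] E => T v) h2)
    (LinearMap.ext fun v => congrArg (fun T : E →L[ℝ] E => T v) h1), fun v => ?_, fun v => ?_⟩
  · change q (fderiv ℝ F x v) = q (D (v + q (fderiv ℝ F x v - D v)))
    rw [map_add, map_add, hqD, map_sub]
    abel
  · have hdF' : HasFDerivAt F (fderiv ℝ F x) (Ψ (Φ x)) := by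
      rw [hΨΦ]
      exact hdF x (hNU hx)
    rw [(hdF'.comp _ (hdΨ _ hξ)).fderiv]
    rfl

/-- The index of the differential of a Fredholm map is locally constant. -/
theorem eventually_index_fderiv_eq {U : Set E} (hU : IsOpen U) {F : E → Y}
    (hF : ContDiffOn ℝ 1 F U) {x₀ : E} (hx₀ : x₀ ∈ U) (hD : (fderiv ℝ F x₀).IsFredholm) :
    ∀ᶠ x in 𝓝 x₀, (fderiv ℝ F x).IsFredholm →
      (fderiv ℝ F x).toLinearMap.index = (fderiv ℝ F x₀).toLinearMap.index := by
  obtain ⟨q, hDq, hqD⟩ := exists_generalizedInverse hD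
  obtain ⟨h1, h2, h3, h4⟩ := hD.finiteDimensional_of_generalizedInverse hDq hqD
  obtain ⟨Φ, Ψ, r, N, -, hNo, hxN, -, -, -, -, hN⟩ :=
    exists_fredholm_coordinates one_ne_zero hU (by exact_mod_cast hF) hx₀ hqD
  filter_upwards [hNo.mem_nhds hxN] with x hx hA
  obtain ⟨b, hb, -⟩ := (hN x hx).2.2
  have := hA.finite_ker
  have := hA.finite_coker.finiteDimensional_quotient
  exact index_eq_of_comp_eq (b := b) (q := q.toLinearMap) hb

variable [MeasurableSpace Y] [BorelSpace Y]

/-- Near `x₀`, a Fredholm map sends the points at which the cokernel of the differential has the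
same nonzero dimension as at `x₀` into a closed set with null translates. In the local coordinates
the map `H` is stationary along `ker D` at these points, so that on each slice parallel to `ker q`
the finite-dimensional statement on points of rank zero applies. -/
theorem exists_local_null_critical_values {k : ℕ} {U : Set E} (hU : IsOpen U) {F : E → Y}
    (hF : ContDiffOn ℝ k F U) {x₀ : E} (hx₀ : x₀ ∈ U) (hD : (fderiv ℝ F x₀).IsFredholm)
    (hcoker : Module.finrank ℝ (Y ⧸ (fderiv ℝ F x₀).range) ≠ 0)
    (hk : max (fderiv ℝ F x₀).toLinearMap.index 0 < k) :
    ∃ Z : Set Y, IsClosed Z ∧ HasNullTranslates Z ∧ ∀ᶠ x in 𝓝 x₀,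
      (fderiv ℝ F x).IsFredholm →
      Module.finrank ℝ (Y ⧸ (fderiv ℝ F x).range) =
        Module.finrank ℝ (Y ⧸ (fderiv ℝ F x₀).range) → F x ∈ Z := by
  have hk0 : k ≠ 0 := by
    have := (le_max_right _ _).trans_lt hk
    lia
  have hk0' : (k : WithTop ℕ∞) ≠ 0 := by exact_mod_cast hk0
  have hk1 : (1 : WithTop ℕ∞) ≤ k := by exact_mod_cast Nat.one_le_iff_ne_zero.2 hk0
  obtain ⟨q, hDq, hqD⟩ := exists_generalizedInverse hD
  obtain ⟨hf1, hf2, hf3, hf4⟩ := hD.finiteDimensional_of_generalizedInverse hDq hqD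
  obtain ⟨Φ, Ψ, r, N, hr, hNo, hxN, hΦx₀, hΦ, hH, hqH, hN⟩ :=
    exists_fredholm_coordinates hk0 hU hF hx₀ hqD
  obtain ⟨eY⟩ := nonempty_quotient_range_equiv_ker (D := (fderiv ℝ F x₀).toLinearMap)
    (q := q.toLinearMap) hDq hqD
  have hindex := eventually_index_fderiv_eq hU (hF.of_le hk1) hx₀ hD
  set D := fderiv ℝ F x₀ with hDdef
  set H : E → Y := F ∘ Ψ with hHdef
  set X₀ : Submodule ℝ E := D.ker with hX₀
  set Y₀ : Submodule ℝ Y := q.ker with hY₀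
  have hpX : ProperSpace X₀ := FiniteDimensional.proper ℝ X₀
  have hdim : Module.finrank ℝ X₀ ≤ k * Module.finrank ℝ Y₀ := by
    have e1 : Module.finrank ℝ (Y ⧸ D.range) = Module.finrank ℝ Y₀ := eY.finrank_eq
    have e2 : D.toLinearMap.index = (Module.finrank ℝ X₀ : ℤ) - Module.finrank ℝ Y₀ := by
      rw [LinearMap.index_eq_finrank_sub, e1]
    have h1 := (le_max_left _ _).trans_lt hk
    rw [e2] at h1
    have hm : 1 ≤ Module.finrank ℝ Y₀ := Nat.one_le_iff_ne_zero.2 (e1 ▸ hcoker)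
    have h2 : Module.finrank ℝ X₀ + 1 ≤ k + Module.finrank ℝ Y₀ := by lia
    have h3 : 1 ≤ k := Nat.one_le_iff_ne_zero.2 hk0
    -- `k m - (k + m - 1) = (k - 1) (m - 1)` for `m = dim ker q`.
    nlinarith
  -- The coordinates of the relevant critical points: those at which `H` is stationary along `ker D`.
  set C : Set E := {ξ ∈ Metric.closedBall x₀ (r / 2) | fderiv ℝ H ξ ∘L X₀.subtypeL = 0} with hC
  have hCball : C ⊆ Metric.ball x₀ r := fun ξ hξ =>
    Metric.closedBall_subset_ball (half_lt_self hr) hξ.1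
  let ρ : E →L[ℝ] X₀ := (ContinuousLinearMap.id ℝ E - q ∘L D).codRestrict X₀ fun v => by
    simp [hX₀, hDq]
  let σ : Y →L[ℝ] Y₀ := (ContinuousLinearMap.id ℝ Y - D ∘L q).codRestrict Y₀ fun y => by
    simp [hY₀, hqD]
  have hσ : ∀ y : Y₀, σ y = y := fun y => by
    ext
    have : q y = 0 := y.2
    simp [σ, this]
  have hdecomp : ∀ ξ ∈ Metric.ball x₀ r, ξ = x₀ + q (H ξ - F x₀) + ρ (ξ - x₀) := fun ξ hξ => by
    have h1 : q (H ξ - F x₀) = q (D (ξ - x₀)) := hqH ξ hξ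
    have h2 : (ρ (ξ - x₀) : E) = (ξ - x₀) - q (D (ξ - x₀)) := rfl
    rw [h1, h2]
    abel
  have hHc : ∀ ξ ∈ Metric.ball x₀ r, ContinuousAt H ξ := fun ξ hξ =>
    hH.continuousOn.continuousAt (Metric.isOpen_ball.mem_nhds hξ)
  have hH'c : ∀ ξ ∈ Metric.ball x₀ r, ContinuousAt (fderiv ℝ H) ξ := fun ξ hξ =>
    (hH.continuousOn_fderiv_of_isOpen Metric.isOpen_ball hk1).continuousAt
      (Metric.isOpen_ball.mem_nhds hξ)
  -- `H` is proper on `C`: the component of `ξ` in `range q` is determined by `H ξ`, and the other one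
  -- is bounded in the finite-dimensional space `ker D`.
  have hZ : IsClosed (H '' C) := by
    refine IsSeqClosed.isClosed fun u y hu hy => ?_
    choose ξ hξ hξu using hu
    have hbdd : ∀ n, ρ (ξ n - x₀) ∈ Metric.closedBall (0 : X₀) (‖ρ‖ * (r / 2)) := fun n => by
      rw [mem_closedBall_zero_iff]
      exact ρ.le_of_opNorm_le_of_le le_rfl (mem_closedBall_iff_norm.1 (hξ n).1)
    obtain ⟨z, -, φ, hφ, hz⟩ := tendsto_subseq_of_bounded Metric.isBounded_closedBall hbdd
    have hlim : Tendsto (ξ ∘ φ) atTop (𝓝 (x₀ + q (y - F x₀) + z)) := by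
      have h1 : Tendsto (fun n => x₀ + q (u (φ n) - F x₀) + (ρ (ξ (φ n) - x₀) : E)) atTop
          (𝓝 (x₀ + q (y - F x₀) + z)) := by
        refine (((q.continuous.tendsto _).comp
          ((hy.comp hφ.tendsto_atTop).sub_const _)).const_add x₀).add ?_
        exact (continuous_subtype_val.tendsto z).comp hz
      refine h1.congr fun n => ?_
      rw [← hξu, ← hdecomp _ (hCball (hξ _))]
      rfl
    set ξ₀ := x₀ + q (y - F x₀) + z with hξ₀
    have hmem : ξ₀ ∈ Metric.closedBall x₀ (r / 2) :=
      Metric.isClosed_closedBall.mem_of_tendsto hlim (Eventually.of_forall fun n => (hξ _).1)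
    have hmem' : ξ₀ ∈ Metric.ball x₀ r := Metric.closedBall_subset_ball (half_lt_self hr) hmem
    refine ⟨ξ₀, ⟨hmem, ?_⟩, ?_⟩
    · have h1 : Tendsto (fun n => fderiv ℝ H ((ξ ∘ φ) n) ∘L X₀.subtypeL) atTop
          (𝓝 (fderiv ℝ H ξ₀ ∘L X₀.subtypeL)) :=
        (((ContinuousLinearMap.compL ℝ X₀ E Y).flip X₀.subtypeL).continuous.tendsto _).comp
          ((hH'c ξ₀ hmem').tendsto.comp hlim)
      refine tendsto_nhds_unique h1 ?_
      exact tendsto_const_nhds.congr fun n => (hξ (φ n)).2.symm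
    · refine tendsto_nhds_unique ((hHc ξ₀ hmem').tendsto.comp hlim) ?_
      exact (hy.comp hφ.tendsto_atTop).congr fun n => (hξu (φ n)).symm
  refine ⟨H '' C, hZ, hasNullTranslates_of_addHaar hZ Y₀ fun x => ?_, ?_⟩
  · -- On the slice `H ξ ∈ -x + ker q` the component of `ξ` in the range of `q` is fixed.
    let ι : X₀ → E := fun z => x₀ + q (-x - F x₀) + z
    have hι : ContDiff ℝ k ι := contDiff_const.add X₀.subtypeL.contDiff
    have hιd : ∀ z, HasFDerivAt ι X₀.subtypeL z := fun z => X₀.subtypeL.hasFDerivAt.const_add _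
    let f : X₀ → Y₀ := fun z => σ (x + H (ι z))
    have hf : ContDiffOn ℝ k f (ι ⁻¹' Metric.ball x₀ r) :=
      σ.contDiff.comp_contDiffOn (contDiffOn_const.add (hH.comp hι.contDiffOn fun z hz => hz))
    have hnull : (Measure.addHaar : Measure Y₀) (f '' (ι ⁻¹' C)) = 0 := by
      refine addHaar_image_eq_zero_of_fderiv_eq_zero _
        (Metric.isOpen_ball.preimage hι.continuous) hf hk0 ?_ hdim
        (preimage_mono hCball) fun z hz => ?_
      · rw [← eY.finrank_eq]
        exact hcoker
      · have hd : HasFDerivAt H (fderiv ℝ H (ι z)) (ι z) :=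
          ((hH.differentiableOn hk0').differentiableAt
            (Metric.isOpen_ball.mem_nhds (hCball hz))).hasFDerivAt
        have h1 := σ.hasFDerivAt.comp z ((hd.comp z (hιd z)).const_add x)
        have h2 := h1.fderiv
        rw [hz.2, ContinuousLinearMap.comp_zero] at h2
        exact h2
    refine measure_mono_null ?_ hnull
    rintro y ⟨_, ⟨ξ, hξ, rfl⟩, hy⟩
    have hqy : q (H ξ) = q (-x) := by
      have h0 : q y = 0 := y.2
      rw [← hy, map_add] at h0
      rw [map_neg]
      exact eq_neg_of_add_eq_zero_right h0
    have hξι : ι (ρ (ξ - x₀)) = ξ := by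
      conv_rhs => rw [hdecomp ξ (hCball hξ)]
      simp only [ι, map_sub, hqy]
    refine ⟨ρ (ξ - x₀), ?_, ?_⟩
    · rw [mem_preimage, hξι]
      exact hξ
    · simp only [f]
      rw [hξι, hy, hσ]
  · have hev : ∀ᶠ x in 𝓝 x₀, Φ x ∈ Metric.closedBall x₀ (r / 2) := by
      refine (hΦ.continuousAt (hNo.mem_nhds hxN)).eventually_mem ?_
      rw [hΦx₀]
      exact Metric.closedBall_mem_nhds _ (half_pos hr)
    filter_upwards [hNo.mem_nhds hxN, hev, hindex] with x hx hxr hxi hA hAcoker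
    obtain ⟨hξ, hΨΦ, b, hb, hb'⟩ := hN x hx
    refine ⟨Φ x, ⟨hxr, ?_⟩, by rw [hHdef, Function.comp_apply, hΨΦ]⟩
    ext z
    have h1 : fderiv ℝ F x (b.symm z) = 0 :=
      apply_eq_zero_of_comp_eq (A := (fderiv ℝ F x).toLinearMap) (D := D.toLinearMap)
        (q := q.toLinearMap) (b := b) hDq (hxi hA) hAcoker hb (by simp)
    simpa [hb'] using h1

end Local

/-! ### Fredholm maps on manifolds -/

section Reparametrize

variable {E Y : Type*} [NormedAddCommGroup E] [NormedSpace ℝ E]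
  [NormedAddCommGroup Y] [NormedSpace ℝ Y] {A B : E →L[ℝ] Y} {a : E ≃L[ℝ] E}

theorem ContinuousLinearMap.IsFredholm.comp_equiv (hB : B.IsFredholm) :
    (B ∘L a : E →L[ℝ] Y).IsFredholm := by
  obtain ⟨v, hv⟩ := hB.exists_isQuasiInverse
  exact .of_isQuasiInverse (v := (a.symm : E →L[ℝ] E) ∘L v)
    (a.toLinearEquiv.isQuasiInverse.comp hv)

theorem range_comp_equiv : (B ∘L a : E →L[ℝ] Y).range = B.range :=
  LinearMap.range_comp_of_range_eq_top _ (LinearEquiv.range a.toLinearEquiv)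

theorem index_comp_equiv :
    (B ∘L a : E →L[ℝ] Y).toLinearMap.index = B.toLinearMap.index := by
  have h1 : Module.finrank ℝ (B ∘L a : E →L[ℝ] Y).ker = Module.finrank ℝ B.ker :=
    (a.toLinearEquiv.ofSubmodule' B.ker).finrank_eq
  rw [LinearMap.index_eq_finrank_sub, LinearMap.index_eq_finrank_sub, range_comp_equiv, h1]

end Reparametrize

/-- The differential of `f : M → Y` at `x`, seen as an operator between the model spaces, which are
definitionally the tangent spaces. -/
noncomputable def modelDeriv (E : Type*) [NormedAddCommGroup E] [NormedSpace ℝ E]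
    {M : Type*} [TopologicalSpace M] [ChartedSpace E M]
    {Y : Type*} [NormedAddCommGroup Y] [NormedSpace ℝ Y] (f : M → Y) (x : M) : E →L[ℝ] Y :=
  mfderiv 𝓘(ℝ, E) 𝓘(ℝ, Y) f x

section Manifold

variable {E : Type*} [NormedAddCommGroup E] [NormedSpace ℝ E]
  {M : Type*} [TopologicalSpace M] [ChartedSpace E M]
  {Y : Type*} [NormedAddCommGroup Y] [NormedSpace ℝ Y] {f : M → Y}

/-- The differentials of `f` and of its expression in a chart differ by an automorphism. -/
theorem exists_fderiv_chart_eq_mfderiv [IsManifold 𝓘(ℝ, E) 1 M]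
    (hf : ContMDiff 𝓘(ℝ, E) 𝓘(ℝ, Y) 1 f) (x₀ : M) {x : M} (hx : x ∈ (chartAt E x₀).source) :
    ∃ a : E ≃L[ℝ] E, fderiv ℝ (f ∘ (chartAt E x₀).symm) (chartAt E x₀ x) =
      modelDeriv E f x ∘L a := by
  set e := chartAt E x₀ with he
  have hF : ContDiffOn ℝ 1 (f ∘ e.symm) e.target :=
    contMDiffOn_iff_contDiffOn.1 (hf.comp_contMDiffOn contMDiffOn_chart_symm)
  have hd : HasFDerivAt (f ∘ e.symm) (fderiv ℝ (f ∘ e.symm) (e x)) (e x) :=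
    ((hF.differentiableOn one_ne_zero).differentiableAt
      (e.open_target.mem_nhds (e.map_source hx))).hasFDerivAt
  have hme := mdifferentiable_chart (I := 𝓘(ℝ, E)) x₀
  have h1 := hd.hasMFDerivAt.comp x (hme.mdifferentiableAt hx).hasMFDerivAt
  have h2 : f =ᶠ[𝓝 x] (f ∘ e.symm) ∘ e := by
    filter_upwards [e.open_source.mem_nhds hx] with y hy
    simp [e.left_inv hy]
  have h3 := (h1.congr_of_eventuallyEq h2).mfderiv
  change modelDeriv E f x = _ at h3
  refine ⟨(hme.mfderiv hx).symm, ?_⟩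
  ext v
  rw [h3]
  exact congrArg (fderiv ℝ (f ∘ e.symm) (e x)) ((hme.mfderiv hx).apply_symm_apply v).symm

variable [CompleteSpace E]

/-- The index of a Fredholm map on a connected manifold is the same at all points. -/
theorem index_mfderiv_eq_mapIndex [ConnectedSpace M] [IsManifold 𝓘(ℝ, E) 1 M]
    (hf : ContMDiff 𝓘(ℝ, E) 𝓘(ℝ, Y) 1 f) (hfred : IsFredholmMap E f) (x : M) :
    (modelDeriv E f x).toLinearMap.index = mapIndex E f := by
  have hfred' : ∀ x, (modelDeriv E f x).IsFredholm := hfred.2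
  have hloc : IsLocallyConstant fun x : M =>
      (modelDeriv E f x).toLinearMap.index := by
    refine (IsLocallyConstant.iff_eventually_eq _).2 fun x₀ => ?_
    set e := chartAt E x₀ with he
    have hx₀ : x₀ ∈ e.source := mem_chart_source E x₀
    have hF : ContDiffOn ℝ 1 (f ∘ e.symm) e.target :=
      contMDiffOn_iff_contDiffOn.1 (hf.comp_contMDiffOn contMDiffOn_chart_symm)
    obtain ⟨a₀, ha₀⟩ := exists_fderiv_chart_eq_mfderiv hf x₀ hx₀
    have hD : (fderiv ℝ (f ∘ e.symm) (e x₀)).IsFredholm := by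
      rw [ha₀]
      exact (hfred' x₀).comp_equiv
    have hev := (e.continuousAt hx₀).eventually
      (eventually_index_fderiv_eq e.open_target hF (e.map_source hx₀) hD)
    filter_upwards [hev, e.open_source.mem_nhds hx₀] with x hx hxe
    obtain ⟨a, ha⟩ := exists_fderiv_chart_eq_mfderiv hf x₀ hxe
    rw [ha₀, ha, index_comp_equiv, index_comp_equiv] at hx
    exact hx (hfred' x).comp_equiv
  exact hloc.apply_eq_of_preconnectedSpace x (Classical.arbitrary M)

variable [MeasurableSpace Y] [BorelSpace Y]

/-- The critical values of a Fredholm map lie in a countable union of closed sets with null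
translates. The critical points are stratified by the dimension of the cokernel, and each stratum
is covered by countably many of the neighbourhoods of `exists_local_null_critical_values`. -/
theorem exists_cover_critical_values [ConnectedSpace M] [SecondCountableTopology M] {k : ℕ}
    [IsManifold 𝓘(ℝ, E) k M] (hf : ContMDiff 𝓘(ℝ, E) 𝓘(ℝ, Y) k f) (hfred : IsFredholmMap E f)
    (hk : max (mapIndex E f) 0 < k) :
    ∃ Z : ℕ → Set Y, (∀ n, IsClosed (Z n) ∧ HasNullTranslates (Z n)) ∧
      ∀ x, ¬ Function.Surjective (mfderiv 𝓘(ℝ, E) 𝓘(ℝ, Y) f x) → f x ∈ ⋃ n, Z n := by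
  have hk1 : (1 : WithTop ℕ∞) ≤ k := by
    have := (le_max_right _ _).trans_lt hk
    exact_mod_cast Nat.one_le_iff_ne_zero.2 (by lia)
  have hM : IsManifold 𝓘(ℝ, E) 1 M := IsManifold.of_le hk1
  have hf1 := hf.of_le hk1
  have hfred' : ∀ x, (modelDeriv E f x).IsFredholm := hfred.2
  let S : ℕ → Set M := fun m => {x | Module.finrank ℝ (Y ⧸ (modelDeriv E f x).range) = m}
  have hlocal : ∀ m ≠ 0, ∀ x₀ ∈ S m, ∃ Z : Set Y, IsClosed Z ∧ HasNullTranslates Z ∧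
      f ⁻¹' Z ∈ 𝓝[S m] x₀ := by
    intro m hm x₀ hx₀S
    set e := chartAt E x₀ with he
    have hx₀ : x₀ ∈ e.source := mem_chart_source E x₀
    have hF : ContDiffOn ℝ k (f ∘ e.symm) e.target :=
      contMDiffOn_iff_contDiffOn.1 (hf.comp_contMDiffOn contMDiffOn_chart_symm)
    obtain ⟨a₀, ha₀⟩ := exists_fderiv_chart_eq_mfderiv hf1 x₀ hx₀
    have hD : (fderiv ℝ (f ∘ e.symm) (e x₀)).IsFredholm := by
      rw [ha₀]
      exact (hfred' x₀).comp_equiv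
    have hr₀ : Module.finrank ℝ (Y ⧸ (fderiv ℝ (f ∘ e.symm) (e x₀)).range) = m := by
      rw [ha₀, range_comp_equiv]
      exact hx₀S
    obtain ⟨Z, hZ, hZnull, hev⟩ := exists_local_null_critical_values e.open_target hF
      (e.map_source hx₀) hD (hr₀ ▸ hm) (by
        rw [ha₀, index_comp_equiv, index_mfderiv_eq_mapIndex hf1 hfred]
        exact hk)
    refine ⟨Z, hZ, hZnull, mem_nhdsWithin_iff_eventually.2 ?_⟩
    filter_upwards [(e.continuousAt hx₀).eventually hev, e.open_source.mem_nhds hx₀]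
      with x hx hxe hxS
    obtain ⟨a, ha⟩ := exists_fderiv_chart_eq_mfderiv hf1 x₀ hxe
    rw [hr₀, ha, range_comp_equiv, Function.comp_apply, e.left_inv hxe] at hx
    exact hx (hfred' x).comp_equiv hxS
  choose! Z hZ hZnull hZnhds using hlocal
  have hcover : ∀ m ≠ 0, ∃ t : Set M, t.Countable ∧ t ⊆ S m ∧ S m ⊆ ⋃ x ∈ t, f ⁻¹' Z m x := by
    intro m hm
    obtain ⟨t, ht, htc, hcov⟩ := TopologicalSpace.countable_cover_nhdsWithin (hZnhds m hm)
    exact ⟨t, htc, ht, hcov⟩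
  choose! t htc htS hcov using hcover
  let 𝒵 : Set (Set Y) := insert ∅ (⋃ m ∈ {m : ℕ | m ≠ 0}, Z m '' t m)
  have h𝒵 : 𝒵.Countable :=
    ((to_countable _).biUnion fun m hm => (htc m hm).image _).insert ∅
  obtain ⟨W, hW⟩ := h𝒵.exists_eq_range ⟨∅, mem_insert _ _⟩
  refine ⟨W, fun n => ?_, fun x hx => ?_⟩
  · have hn : W n ∈ 𝒵 := hW ▸ mem_range_self n
    rcases hn with hn | hn
    · rw [hn]
      exact ⟨isClosed_empty, hasNullTranslates_empty⟩
    · obtain ⟨m, hm, x, hx, hxn⟩ := mem_iUnion₂.1 hn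
      rw [← hxn]
      exact ⟨hZ m hm x (htS m hm hx), hZnull m hm x (htS m hm hx)⟩
  · set m := Module.finrank ℝ (Y ⧸ (modelDeriv E f x).range) with hm
    have hm0 : m ≠ 0 := by
      intro h0
      have hfin : FiniteDimensional ℝ (Y ⧸ (modelDeriv E f x).range) :=
        (hfred' x).finite_coker.finiteDimensional_quotient
      have h1 := Module.finrank_zero_iff.1 (hm.symm.trans h0)
      exact hx (LinearMap.range_eq_top.1 (Submodule.Quotient.subsingleton_iff.1 h1))
    obtain ⟨x₁, hx₁, hfx⟩ := mem_iUnion₂.1 (hcov m hm0 hm.symm)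
    have hmem : Z m x₁ ∈ 𝒵 :=
      mem_insert_of_mem _ (mem_iUnion₂.2 ⟨m, hm0, mem_image_of_mem _ hx₁⟩)
    rw [hW] at hmem
    obtain ⟨n, hn⟩ := hmem
    exact mem_iUnion.2 ⟨n, hn ▸ hfx⟩

end Manifold

theorem theorem2
    {E : Type*} [NormedAddCommGroup E] [NormedSpace ℝ E] [CompleteSpace E]
    {M : Type*} [TopologicalSpace M] [ChartedSpace E M]
    [ConnectedSpace M] [SecondCountableTopology M]
    {Y : Type*} [NormedAddCommGroup Y] [NormedSpace ℝ Y] [CompleteSpace Y]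
    [TopologicalSpace.SeparableSpace Y] [MeasurableSpace Y] [BorelSpace Y]
    (k : ℕ∞) [IsManifold 𝓘(ℝ, E) k M]
    (V : Set Y) (hV : IsOpen V)
    (f : M → Y) (hfV : ∀ x, f x ∈ V)
    (hf : ContMDiff 𝓘(ℝ, E) 𝓘(ℝ, Y) k f)
    (hfred : IsFredholmMap E f)
    (hk : ((max (mapIndex E f) 0).toNat : ℕ∞) < k) :
    IsGenericIn V {y ∈ V | IsRegularValue E f y} ∧
      IsPrevalentIn V {y ∈ V | IsRegularValue E f y} := by
  set l : ℕ := (max (mapIndex E f) 0).toNat + 1 with hl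
  have hlk : (l : ℕ∞) ≤ k := by
    rw [hl, Nat.cast_add, Nat.cast_one]
    exact Order.add_one_le_of_lt hk
  have hlk' : (l : WithTop ℕ∞) ≤ (k : WithTop ℕ∞) := by exact_mod_cast hlk
  have hM : IsManifold 𝓘(ℝ, E) l M := IsManifold.of_le hlk'
  have hl' : max (mapIndex E f) 0 < l := by
    have := Int.self_le_toNat (max (mapIndex E f) 0)
    lia
  obtain ⟨Z, hZ, hcrit⟩ := exists_cover_critical_values (hf.of_le hlk') hfred hl'
  have hreg : ∀ y, y ∉ ⋃ n, Z n → IsRegularValue E f y := fun y hy x hxy => by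
    by_contra h
    exact hy (hxy ▸ hcrit x h)
  refine ⟨⟨fun y hy => hy.1, fun n => V ∩ (Z n)ᶜ, fun n => ⟨?_, inter_subset_left, ?_⟩, ?_⟩,
    fun y hy => hy.1, ?_⟩
  · exact hV.inter (hZ n).1.isOpen_compl
  · exact (hZ n).2.dense_compl.open_subset_closure_inter hV
  · intro y hy
    rw [mem_iInter] at hy
    refine ⟨(hy 0).1, hreg y fun hyZ => ?_⟩
    obtain ⟨n, hn⟩ := mem_iUnion.1 hyZ
    exact (hy n).2 hn
  · have hm : ∀ n, MeasurableSet (Z n) := fun n => (hZ n).1.measurableSet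
    refine ⟨⋃ n, Z n, MeasurableSet.iUnion hm, fun y hy => ?_,
      HasNullTranslates.iUnion hm fun n => (hZ n).2⟩
    by_contra h
    exact hy.2 ⟨hy.1, hreg y h⟩
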